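/- Let $N\ge 1$, let $\Omega\subset\mathbb{R}^N$ be a bounded domain (a nonempty, bounded, connected open set) with boundary of class $C^2$, put $d(x)=\operatorname{dist}(x,\partial\Omega)$, and for $\sigma>0$ let $\Gamma_\sigma=\{x\in\overline\Omega:\ d(x)<\sigma\}$. Let $\beta<1$ and let $f\in C(\overline\Omega)$ with $f\ge 0$ and $f\not\equiv 0$ in $\Omega$. Suppose that $u\in C^2(\Omega)\cap C(\overline\Omega)$ solves $$-\operatorname{div}(d^\beta\nabla u)=f\ \text{ in }\Omega,\qquad u=0\ \text{ on }\partial\Omega.$$ (Since $d$ is in general only Lipschitz, the field $d^\beta\nabla u$ is locally Lipschitz in $\Omega$ and differentiable at almost every point of $\Omega$; the equation is required to hold at almost every point of $\Omega$.) Then for all $\eta_1,\eta_2>0$ there exist $\sigma\in(0,1)$ and constants $D_1,D_2>0$ such that $$D_1\,d(x)^{1-\beta}(-\log d(x))^{-\eta_1}\le u(x)\le D_2\,d(x)^{1-\beta}(-\log d(x))^{\eta_2}\qquad\text{for all }x\in\Gamma_\sigma^\circ,$$ where $\Gamma_\sigma^\circ$ is the interior of $\Gamma_\sigma$. Moreover,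 if $\Omega$ is convex, then with the same $\sigma, D_1,D_2$ $$D_1\,d(x)^{1-\beta}(-\log d(x))^{-\eta_1}\le u(x)\le D_2\,d(x)^{1-\beta}\qquad\text{for all }x\in\Gamma_\sigma,$$ where the left-hand side is read as $0$ (its limit) at points of $\partial\Omega$. -/

import Mathlib

namespace DegPoisson

/-- An open set `Ω ⊆ ℝᴺ` has boundary of class `C²`: near each boundary point `p`, the set `Ω` is
the sublevel set `{ρ < 0}` of a `C²` function `ρ` whose derivative does not vanish at `p`. -/
def HasC2Boundary {N : ℕ} (Ω : Set (EuclideanSpace ℝ (Fin N))) : Prop :=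
  ∀ p ∈ frontier Ω, ∃ (U : Set (EuclideanSpace ℝ (Fin N))) (ρ : EuclideanSpace ℝ (Fin N) → ℝ),
    IsOpen U ∧ p ∈ U ∧ ContDiffOn ℝ 2 ρ U ∧ fderiv ℝ ρ p ≠ 0 ∧
      Ω ∩ U = {x ∈ U | ρ x < 0}

/-- The distance to the boundary, `d(x) = dist(x, ∂Ω)`. -/
noncomputable def bdist {N : ℕ} (Ω : Set (EuclideanSpace ℝ (Fin N)))
    (x : EuclideanSpace ℝ (Fin N)) : ℝ :=
  Metric.infDist x (frontier Ω)

/-- The divergence `∑ᵢ ∂ᵢ Fᵢ` of a vector field on `ℝᴺ`. -/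
noncomputable def divergence {N : ℕ}
    (F : EuclideanSpace ℝ (Fin N) → EuclideanSpace ℝ (Fin N))
    (x : EuclideanSpace ℝ (Fin N)) : ℝ :=
  ∑ i, (fderiv ℝ F x (EuclideanSpace.single i 1)) i

/-- The weighted gradient field `d^β ∇u`. -/
noncomputable def flux {N : ℕ} (Ω : Set (EuclideanSpace ℝ (Fin N))) (β : ℝ)
    (u : EuclideanSpace ℝ (Fin N) → ℝ) (x : EuclideanSpace ℝ (Fin N)) :
    EuclideanSpace ℝ (Fin N) :=
  (bdist Ω x) ^ β • gradient u x

/-- `u ∈ C²(Ω) ∩ C(Ω̄)` solves `-div(d^β ∇u) = f` in `Ω`, `u = 0` on `∂Ω`.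

The distance `d` is only Lipschitz away from the boundary, so for `u ∈ C²(Ω)` the field `d^β ∇u`
is locally Lipschitz in `Ω`, hence differentiable at almost every point but in general not at
every point. The equation is required at almost every point of `Ω`, which for such a field is the
same as requiring it in the sense of distributions, and is implied by requiring it everywhere. -/
structure IsSolution {N : ℕ} (Ω : Set (EuclideanSpace ℝ (Fin N))) (β : ℝ)
    (f u : EuclideanSpace ℝ (Fin N) → ℝ) : Prop where
  contDiffOn : ContDiffOn ℝ 2 u Ω
  continuousOn : ContinuousOn u (closure Ω)
  equation : ∀ᵐ x ∂(MeasureTheory.volume : MeasureTheory.Measure (EuclideanSpace ℝ (Fin N))),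
    x ∈ Ω → DifferentiableAt ℝ (flux Ω β u) x ∧ -divergence (flux Ω β u) x = f x
  boundary : ∀ x ∈ frontier Ω, u x = 0

/-- `Γ_σ = {x ∈ Ω̄ : d(x) < σ}`. -/
def strip {N : ℕ} (Ω : Set (EuclideanSpace ℝ (Fin N))) (σ : ℝ) :
    Set (EuclideanSpace ℝ (Fin N)) :=
  {x ∈ closure Ω | bdist Ω x < σ}

end DegPoisson

namespace DegPoisson
open Filter Topology RealInnerProductSpace

variable {N : ℕ}

/-! Near the boundary the stronger bound `c d^(1-β) ≤ u ≤ C d^(1-β)` holds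
(`IsSolution.exists_two_sided_bound`). Both assertions follow, because `-log d ≥ 1` on a thin strip.

The bound comes from comparing `u` with `φ(d)`, where `φ(t) = C (t^(1-β) ∓ t^(3/2-β))`. The power
`t^(1-β)` solves `φ'' + β φ'/t = 0`. The correction contributes a term of order `t^(-1/2-β)`, which
for small `t` beats both the curvature term and the source `f d^(-β)`, each of order `t^(-β)`. Upper
sign: supersolution; lower sign: subsolution.

The distance need not be differentiable, so `φ(d)` is never differentiated twice. Where it touches
`u`, it is replaced by a smooth radial function built on an interior or exterior ball, which touches
`u` at the same point (`IsSolution.contact_above`, `IsSolution.contact_below`). The balls have a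
uniform radius because the boundary is `C²` and compact. The equation, given almost everywhere,
passes to every point with some nearest boundary point in place of `∇d`
(`IsSolution.nondivergence`). The lower bound also needs `u > 0` inside, which is the strong maximum
principle. -/

/-! ### Derivative tests where a radial function touches `u` -/

theorem second_deriv_nonpos_of_isLocalMax {h h' : ℝ → ℝ} {c x : ℝ}
    (hd : ∀ᶠ t in 𝓝 x, HasDerivAt h (h' t) t) (hd' : HasDerivAt h' c x)
    (hmax : IsLocalMax h x) : c ≤ 0 := by
  by_contra! hc
  have h0 : h' x = 0 := hmax.hasDerivAt_eq_zero hd.self_of_nhds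
  -- If `c > 0`, subtracting `c/4 (t - x)²` leaves second derivative `c/2 > 0`. The difference then
  -- has a local minimum at `x`, so `h` has a strict one, against `hmax`.
  have e1 : deriv (fun t => h t - c / 4 * (t - x) ^ 2) =ᶠ[𝓝 x]
      fun t => h' t - c / 2 * (t - x) := by
    filter_upwards [hd] with t ht
    have : HasDerivAt (fun t => h t - c / 4 * (t - x) ^ 2)
        (h' t - c / 4 * (2 * (t - x))) t := by
      have h1 := (((hasDerivAt_id' t).sub_const x).fun_pow 2).const_mul (c / 4)
      simp only [Nat.cast_ofNat, Nat.add_one_sub_one, pow_one, mul_one] at h1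
      exact ht.fun_sub h1
    rw [this.deriv]; ring
  have e2 : deriv (deriv (fun t => h t - c / 4 * (t - x) ^ 2)) x = c / 2 := by
    rw [e1.deriv_eq]
    have : HasDerivAt (fun t => h' t - c / 2 * (t - x)) (c - c / 2 * 1) x :=
      hd'.sub (((hasDerivAt_id x).sub_const x).const_mul (c / 2))
    rw [this.deriv]; ring
  have hmin : IsLocalMin (fun t => h t - c / 4 * (t - x) ^ 2) x := by
    apply isLocalMin_of_deriv_deriv_pos
    · rw [e2]; linarith
    · rw [e1.self_of_nhds]; simp [h0]
    · exact hd.self_of_nhds.continuousAt.sub (by fun_prop)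
  have hne : ∀ᶠ t in 𝓝[≠] x, False := by
    filter_upwards [nhdsWithin_le_nhds hmin, nhdsWithin_le_nhds hmax, self_mem_nhdsWithin]
      with t h1 h2 h3
    simp only [sub_self] at h1
    have : 0 < (t - x) ^ 2 := by
      have := sub_ne_zero.2 h3
      positivity
    nlinarith
  exact hne.exists.elim fun _ h => h

theorem contDiffOn_gradient {Ω : Set (EuclideanSpace ℝ (Fin N))} (hΩ : IsOpen Ω)
    {u : EuclideanSpace ℝ (Fin N) → ℝ} (hu : ContDiffOn ℝ 2 u Ω) :
    ContDiffOn ℝ 1 (gradient u) Ω := by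
  have h := hu.fderiv_of_isOpen hΩ (m := 1) (by norm_num)
  exact (InnerProductSpace.toDual ℝ
    (EuclideanSpace ℝ (Fin N))).symm.toContinuousLinearEquiv.contDiff.comp_contDiffOn h

theorem continuousOn_divergence_gradient {Ω : Set (EuclideanSpace ℝ (Fin N))} (hΩ : IsOpen Ω)
    {u : EuclideanSpace ℝ (Fin N) → ℝ} (hu : ContDiffOn ℝ 2 u Ω) :
    ContinuousOn (divergence (gradient u)) Ω := by
  have h := (contDiffOn_gradient hΩ hu).continuousOn_fderiv_of_isOpen hΩ le_rfl
  unfold divergence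
  refine continuousOn_finsetSum _ fun i _ => ?_
  exact (EuclideanSpace.proj (𝕜 := ℝ) i).continuous.comp_continuousOn
    (h.clm_apply continuousOn_const)

/-- First and second order conditions along a line when a radial function touches `u` from above. -/
theorem touching_line {Ω : Set (EuclideanSpace ℝ (Fin N))} (hΩ : IsOpen Ω)
    {u : EuclideanSpace ℝ (Fin N) → ℝ} (hu : ContDiffOn ℝ 2 u Ω)
    {x q : EuclideanSpace ℝ (Fin N)} (hx : x ∈ Ω) {G G1 : ℝ → ℝ} {G2 : ℝ}
    (hG : ∀ᶠ s in 𝓝 (‖x - q‖ ^ 2), HasDerivAt G (G1 s) s)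
    (hG1 : HasDerivAt G1 G2 (‖x - q‖ ^ 2))
    (hmax : IsLocalMax (fun y => u y - G (‖y - q‖ ^ 2)) x) (e : EuclideanSpace ℝ (Fin N)) :
    ⟪gradient u x, e⟫ = 2 * G1 (‖x - q‖ ^ 2) * ⟪x - q, e⟫ ∧
      ⟪fderiv ℝ (gradient u) x e, e⟫ ≤
        4 * G2 * ⟪x - q, e⟫ ^ 2 + 2 * G1 (‖x - q‖ ^ 2) * ‖e‖ ^ 2 := by
  have hl : ∀ t : ℝ, HasDerivAt (fun t : ℝ => x + t • e) e t := fun t => by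
    simpa using ((hasDerivAt_id t).smul_const e).const_add x
  have hc : Tendsto (fun t : ℝ => x + t • e) (𝓝 0) (𝓝 x) := by
    simpa using (hl 0).continuousAt.tendsto
  have hs : ∀ t : ℝ, HasDerivAt (fun t : ℝ => ‖x + t • e - q‖ ^ 2)
      (2 * ⟪x + t • e - q, e⟫) t := fun t => ((hl t).sub_const q).norm_sq
  have hcs : Tendsto (fun t : ℝ => ‖x + t • e - q‖ ^ 2) (𝓝 0) (𝓝 (‖x - q‖ ^ 2)) := by
    simpa using (hs 0).continuousAt.tendsto
  have hd : ∀ᶠ t : ℝ in 𝓝 0, HasDerivAt (fun t : ℝ => u (x + t • e) - G (‖x + t • e - q‖ ^ 2))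
      (⟪gradient u (x + t • e), e⟫ -
        G1 (‖x + t • e - q‖ ^ 2) * (2 * ⟪x + t • e - q, e⟫)) t := by
    filter_upwards [hc.eventually (hΩ.mem_nhds hx), hcs.eventually hG] with t ht1 ht2
    have h1 : HasGradientAt u (gradient u (x + t • e)) (x + t • e) :=
      ((hu.differentiableOn two_ne_zero).differentiableAt (hΩ.mem_nhds ht1)).hasGradientAt
    have h2 := h1.hasFDerivAt.comp_hasDerivAt t (hl t)
    exact h2.fun_sub (ht2.comp t (hs t))
  have hd' : HasDerivAt (fun t : ℝ => ⟪gradient u (x + t • e), e⟫ -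
        G1 (‖x + t • e - q‖ ^ 2) * (2 * ⟪x + t • e - q, e⟫))
      (⟪fderiv ℝ (gradient u) x e, e⟫ - (G2 * (2 * ⟪x - q, e⟫) * (2 * ⟪x - q, e⟫) +
        G1 (‖x - q‖ ^ 2) * (2 * ⟪e, e⟫))) 0 := by
    have hx0 : x + (0 : ℝ) • e = x := by simp
    have h1 : HasFDerivAt (gradient u) (fderiv ℝ (gradient u) x) (x + (0 : ℝ) • e) := by
      rw [hx0]
      exact (((contDiffOn_gradient hΩ hu).differentiableOn one_ne_zero).differentiableAt
        (hΩ.mem_nhds hx)).hasFDerivAt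
    have h2 := (h1.comp_hasDerivAt (0 : ℝ) (hl 0)).inner ℝ (hasDerivAt_const (0 : ℝ) e)
    have h3 : HasDerivAt (fun t : ℝ => 2 * ⟪x + t • e - q, e⟫) (2 * ⟪e, e⟫) 0 := by
      simpa using (((hl 0).sub_const q).inner ℝ (hasDerivAt_const (0 : ℝ) e)).const_mul 2
    have h4 : HasDerivAt (fun t : ℝ => G1 (‖x + t • e - q‖ ^ 2))
        (G2 * (2 * ⟪x + (0 : ℝ) • e - q, e⟫)) 0 := by
      refine HasDerivAt.comp (0 : ℝ) (h₂ := G1) ?_ (hs 0)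
      rwa [hx0]
    have h5 := h2.fun_sub (h4.fun_mul h3)
    simpa using h5
  have hm : IsLocalMax (fun t : ℝ => u (x + t • e) - G (‖x + t • e - q‖ ^ 2)) 0 := by
    have := hc.eventually hmax
    filter_upwards [this] with t ht
    simpa using ht
  constructor
  · have := hm.hasDerivAt_eq_zero hd.self_of_nhds
    simp only [zero_smul, add_zero] at this
    linarith
  · have := second_deriv_nonpos_of_isLocalMax hd hd' hm
    rw [real_inner_self_eq_norm_sq] at this
    linarith

/-- Summing the second-order condition over the coordinate directions produces the Laplacian of
`G(‖y - q‖²)` on the right. -/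
theorem touching_above {Ω : Set (EuclideanSpace ℝ (Fin N))} (hΩ : IsOpen Ω)
    {u : EuclideanSpace ℝ (Fin N) → ℝ} (hu : ContDiffOn ℝ 2 u Ω)
    {x q : EuclideanSpace ℝ (Fin N)} (hx : x ∈ Ω) {G G1 : ℝ → ℝ} {G2 : ℝ}
    (hG : ∀ᶠ s in 𝓝 (‖x - q‖ ^ 2), HasDerivAt G (G1 s) s)
    (hG1 : HasDerivAt G1 G2 (‖x - q‖ ^ 2))
    (hmax : IsLocalMax (fun y => u y - G (‖y - q‖ ^ 2)) x) :
    gradient u x = (2 * G1 (‖x - q‖ ^ 2)) • (x - q) ∧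
      divergence (gradient u) x ≤ 4 * ‖x - q‖ ^ 2 * G2 + 2 * N * G1 (‖x - q‖ ^ 2) := by
  have key := touching_line hΩ hu hx hG hG1 hmax
  constructor
  · refine ext_inner_right ℝ fun v => ?_
    rw [(key v).1, real_inner_smul_left]
  · have : ∀ i : Fin N, (fderiv ℝ (gradient u) x (EuclideanSpace.single i 1)) i ≤
        4 * G2 * ((x - q) i) ^ 2 + 2 * G1 (‖x - q‖ ^ 2) := fun i => by
      simpa [EuclideanSpace.inner_single_right] using (key (EuclideanSpace.single i 1)).2
    refine (Finset.sum_le_sum fun i _ => this i).trans (le_of_eq ?_)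
    rw [Finset.sum_add_distrib, ← Finset.mul_sum, ← EuclideanSpace.real_norm_sq_eq]
    simp
    ring

theorem gradient_neg (u : EuclideanSpace ℝ (Fin N) → ℝ) :
    gradient (fun y => -u y) = fun y => -gradient u y := by
  funext y
  simp [gradient, fderiv_fun_neg]

theorem divergence_neg (F : EuclideanSpace ℝ (Fin N) → EuclideanSpace ℝ (Fin N))
    (x : EuclideanSpace ℝ (Fin N)) :
    divergence (fun y => -F y) x = -divergence F x := by
  simp [divergence, fderiv_fun_neg]

theorem touching_below {Ω : Set (EuclideanSpace ℝ (Fin N))} (hΩ : IsOpen Ω)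
    {u : EuclideanSpace ℝ (Fin N) → ℝ} (hu : ContDiffOn ℝ 2 u Ω)
    {x q : EuclideanSpace ℝ (Fin N)} (hx : x ∈ Ω) {G G1 : ℝ → ℝ} {G2 : ℝ}
    (hG : ∀ᶠ s in 𝓝 (‖x - q‖ ^ 2), HasDerivAt G (G1 s) s)
    (hG1 : HasDerivAt G1 G2 (‖x - q‖ ^ 2))
    (hmin : IsLocalMin (fun y => u y - G (‖y - q‖ ^ 2)) x) :
    gradient u x = (2 * G1 (‖x - q‖ ^ 2)) • (x - q) ∧
      4 * ‖x - q‖ ^ 2 * G2 + 2 * N * G1 (‖x - q‖ ^ 2) ≤ divergence (gradient u) x := by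
  have h := touching_above hΩ hu.neg hx (G := fun s => -G s) (G1 := fun s => -G1 s) (G2 := -G2)
    (hG.mono fun s hs => hs.neg) hG1.neg (by
      filter_upwards [hmin] with y hy
      linarith)
  rw [gradient_neg, divergence_neg] at h
  refine ⟨?_, by linarith [h.2]⟩
  have := h.1
  simp only at this
  rw [neg_eq_iff_eq_neg] at this
  rw [this, ← neg_smul]
  congr 1; ring

/-! ### The boundary distance and the equation at every point -/

theorem isCompact_frontier_of_isBounded {Ω : Set (EuclideanSpace ℝ (Fin N))}
    (hb : Bornology.IsBounded Ω) : IsCompact (frontier Ω) :=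
  hb.isCompact_closure.of_isClosed_subset isClosed_frontier frontier_subset_closure

theorem exists_nearest {Ω : Set (EuclideanSpace ℝ (Fin N))}
    (hb : Bornology.IsBounded Ω) (hne : (frontier Ω).Nonempty) (x : EuclideanSpace ℝ (Fin N)) :
    ∃ p ∈ frontier Ω, ‖x - p‖ = bdist Ω x := by
  obtain ⟨p, hp, h⟩ := (isCompact_frontier_of_isBounded hb).exists_infDist_eq_dist hne x
  exact ⟨p, hp, by rw [bdist, h, dist_eq_norm]⟩

theorem continuous_bdist (Ω : Set (EuclideanSpace ℝ (Fin N))) : Continuous (bdist Ω) :=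
  Metric.continuous_infDist_pt _

theorem bdist_le_norm_sub {Ω : Set (EuclideanSpace ℝ (Fin N))} {p : EuclideanSpace ℝ (Fin N)}
    (hp : p ∈ frontier Ω) (x : EuclideanSpace ℝ (Fin N)) : bdist Ω x ≤ ‖x - p‖ := by
  rw [← dist_eq_norm]
  exact Metric.infDist_le_dist_of_mem hp

theorem bdist_nonneg (Ω : Set (EuclideanSpace ℝ (Fin N))) (x : EuclideanSpace ℝ (Fin N)) :
    0 ≤ bdist Ω x := Metric.infDist_nonneg

theorem bdist_pos {Ω : Set (EuclideanSpace ℝ (Fin N))} (hΩ : IsOpen Ω)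
    (hne : (frontier Ω).Nonempty) {x : EuclideanSpace ℝ (Fin N)} (hx : x ∈ Ω) :
    0 < bdist Ω x := by
  refine (isClosed_frontier.notMem_iff_infDist_pos hne).1 fun h => ?_
  rw [hΩ.frontier_eq] at h
  exact h.2 hx

/-- The function `‖y - p‖² - d(y)²` is nonnegative and vanishes at `x`, so its derivative there is
zero. -/
theorem fderiv_bdist {Ω : Set (EuclideanSpace ℝ (Fin N))} {x p : EuclideanSpace ℝ (Fin N)}
    (hd : DifferentiableAt ℝ (bdist Ω) x) (hpos : 0 < bdist Ω x) (hp : p ∈ frontier Ω)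
    (hxp : ‖x - p‖ = bdist Ω x) (v : EuclideanSpace ℝ (Fin N)) :
    fderiv ℝ (bdist Ω) x v = ⟪x - p, v⟫ / bdist Ω x := by
  have h1 : HasFDerivAt (fun y => ‖y - p‖ ^ 2 - bdist Ω y ^ 2)
      ((2 • innerSL ℝ (x - p)).comp (ContinuousLinearMap.id ℝ _) -
        (2 * bdist Ω x ^ 1) • fderiv ℝ (bdist Ω) x) x := by
    refine HasFDerivAt.fun_sub ?_ ?_
    · simpa using ((hasFDerivAt_id x).sub_const p).norm_sq
    · simpa using hd.hasFDerivAt.pow 2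
  have hmin : IsLocalMin (fun y => ‖y - p‖ ^ 2 - bdist Ω y ^ 2) x := by
    refine Filter.Eventually.of_forall fun y => ?_
    have := bdist_le_norm_sub hp y
    have h0 := bdist_nonneg Ω y
    simp only [hxp, sub_self]
    nlinarith
  have h2 := congrArg (fun L : EuclideanSpace ℝ (Fin N) →L[ℝ] ℝ => L v) (hmin.hasFDerivAt_eq_zero h1)
  simp [← inner_sub_left] at h2
  field_simp
  linarith

theorem divergence_flux {Ω : Set (EuclideanSpace ℝ (Fin N))} (hΩ : IsOpen Ω) {β : ℝ}
    {u : EuclideanSpace ℝ (Fin N) → ℝ} (hu : ContDiffOn ℝ 2 u Ω)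
    {x : EuclideanSpace ℝ (Fin N)} (hx : x ∈ Ω) (hpos : 0 < bdist Ω x)
    (hd : DifferentiableAt ℝ (bdist Ω) x) :
    divergence (flux Ω β u) x = bdist Ω x ^ β * divergence (gradient u) x +
      β * bdist Ω x ^ (β - 1) * fderiv ℝ (bdist Ω) x (gradient u x) := by
  have h1 : HasFDerivAt (gradient u) (fderiv ℝ (gradient u) x) x :=
    (((contDiffOn_gradient hΩ hu).differentiableOn one_ne_zero).differentiableAt
        (hΩ.mem_nhds hx)).hasFDerivAt
  have h2 := hd.hasFDerivAt.rpow_const (p := β) (Or.inl hpos.ne')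
  have h3 : HasFDerivAt (flux Ω β u) _ x := h2.smul h1
  have h4 : fderiv ℝ (bdist Ω) x (gradient u x) =
      ∑ i, fderiv ℝ (bdist Ω) x (EuclideanSpace.single i 1) * (gradient u x) i := by
    conv_lhs => rw [← (EuclideanSpace.basisFun (Fin N) ℝ).sum_repr (gradient u x)]
    simp [mul_comm]
  rw [divergence, h3.fderiv, h4, divergence, Finset.mul_sum, Finset.mul_sum,
    ← Finset.sum_add_distrib]
  refine Finset.sum_congr rfl fun i _ => ?_
  simp
  ring

/-- By Rademacher's theorem, the points where `d` is differentiable and the equation holds are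
dense. Along a sequence of them tending to `x`, the nearest boundary points subconverge by
compactness, and everything else in the equation is continuous. -/
theorem IsSolution.equation_everywhere {Ω : Set (EuclideanSpace ℝ (Fin N))} (hΩ : IsOpen Ω)
    (hb : Bornology.IsBounded Ω) (hne : (frontier Ω).Nonempty) {β : ℝ}
    {f u : EuclideanSpace ℝ (Fin N) → ℝ} (hf : ContinuousOn f (closure Ω))
    (hu : IsSolution Ω β f u) {x : EuclideanSpace ℝ (Fin N)} (hx : x ∈ Ω) :
    ∃ p ∈ frontier Ω, ‖x - p‖ = bdist Ω x ∧
      bdist Ω x ^ β * divergence (gradient u) x +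
        β * bdist Ω x ^ (β - 1) * (⟪x - p, gradient u x⟫ / bdist Ω x) = -f x := by
  have hlip : LipschitzWith 1 (bdist Ω) := Metric.lipschitz_infDist_pt _
  have hdense := MeasureTheory.Measure.dense_of_ae (hu.equation.and hlip.ae_differentiableAt)
  obtain ⟨y, hy, hyx⟩ := mem_closure_iff_seq_limit.1 (hdense x)
  choose p hp hyp using fun n => exists_nearest hb hne (y n)
  obtain ⟨p₀, hp₀, φ, hφ, hlim⟩ :=
    (isCompact_frontier_of_isBounded hb).tendsto_subseq (x := p) hp
  have hyφ : Tendsto (fun n => y (φ n)) atTop (𝓝 x) := hyx.comp hφ.tendsto_atTop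
  have hdφ : Tendsto (fun n => bdist Ω (y (φ n))) atTop (𝓝 (bdist Ω x)) :=
    ((continuous_bdist Ω).tendsto x).comp hyφ
  have hdiff : Tendsto (fun n => y (φ n) - p (φ n)) atTop (𝓝 (x - p₀)) := hyφ.sub hlim
  have hpos := bdist_pos hΩ hne hx
  have hgrad : Tendsto (fun n => gradient u (y (φ n))) atTop (𝓝 (gradient u x)) :=
    ((contDiffOn_gradient hΩ hu.contDiffOn).continuousOn.continuousAt (hΩ.mem_nhds hx)).tendsto.comp
      hyφ
  have hdiv : Tendsto (fun n => divergence (gradient u) (y (φ n))) atTop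
      (𝓝 (divergence (gradient u) x)) :=
    ((continuousOn_divergence_gradient hΩ hu.contDiffOn).continuousAt
      (hΩ.mem_nhds hx)).tendsto.comp hyφ
  have hff : Tendsto (fun n => f (y (φ n))) atTop (𝓝 (f x)) :=
    ((hf.mono subset_closure).continuousAt (hΩ.mem_nhds hx)).tendsto.comp hyφ
  refine ⟨p₀, hp₀, tendsto_nhds_unique hdiff.norm (hdφ.congr fun n => (hyp _).symm), ?_⟩
  refine tendsto_nhds_unique (((hdφ.rpow_const (Or.inl hpos.ne')).mul hdiv).add
    (((hdφ.rpow_const (Or.inl hpos.ne')).const_mul β).mul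
      ((hdiff.inner hgrad).div hdφ hpos.ne'))) (hff.neg.congr' ?_)
  filter_upwards [hyφ.eventually (hΩ.mem_nhds hx)] with n hn
  have hposn := bdist_pos hΩ hne hn
  obtain ⟨h1, h2⟩ := hy (φ n)
  simp only [Pi.div_apply]
  rw [← fderiv_bdist h2 hposn (hp _) (hyp _), ← divergence_flux hΩ hu.contDiffOn hn hposn h2,
    ← (h1 hn).2, neg_neg]

/-- The equation in nondivergence form, valid at every point, with `x - p` for some nearest
boundary point `p` in place of `d(x) ∇d(x)`. -/
theorem IsSolution.nondivergence {Ω : Set (EuclideanSpace ℝ (Fin N))} (hΩ : IsOpen Ω)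
    (hb : Bornology.IsBounded Ω) (hne : (frontier Ω).Nonempty) {β : ℝ}
    {f u : EuclideanSpace ℝ (Fin N) → ℝ} (hf : ContinuousOn f (closure Ω))
    (hu : IsSolution Ω β f u) {x : EuclideanSpace ℝ (Fin N)} (hx : x ∈ Ω) :
    ∃ p ∈ frontier Ω, ‖x - p‖ = bdist Ω x ∧
      divergence (gradient u) x + β / bdist Ω x ^ 2 * ⟪x - p, gradient u x⟫ =
        -(f x * bdist Ω x ^ (-β)) := by
  obtain ⟨p, hp, hxp, h⟩ := hu.equation_everywhere hΩ hb hne hf hx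
  have hpos := bdist_pos hΩ hne hx
  refine ⟨p, hp, hxp, ?_⟩
  have h1 : bdist Ω x ^ β * bdist Ω x ^ (-β) = 1 := by
    rw [← Real.rpow_add hpos]; simp
  rw [Real.rpow_sub_one hpos.ne'] at h
  rw [← neg_mul, ← h]
  field_simp
  linear_combination (-(bdist Ω x ^ 2 * divergence (gradient u) x) -
    β * ⟪x - p, gradient u x⟫) * h1

/-! ### Strong maximum principle and positivity -/

/-- The barrier step of the strong maximum principle: `u` cannot attain its minimum at a single
point of the boundary of a ball. -/
theorem not_min_on_touching_ball {Ω : Set (EuclideanSpace ℝ (Fin N))} (hΩ : IsOpen Ω)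
    {u B : EuclideanSpace ℝ (Fin N) → ℝ} (hu : ContDiffOn ℝ 2 u Ω) (hB : ContinuousOn B Ω)
    (hL : ∀ x ∈ Ω, ∃ b : EuclideanSpace ℝ (Fin N), ‖b‖ ≤ B x ∧
      divergence (gradient u) x + ⟪b, gradient u x⟫ ≤ 0)
    {m : ℝ} (hm : ∀ x ∈ Ω, m ≤ u x) {c w : EuclideanSpace ℝ (Fin N)} (hw : w ∈ Ω)
    (hcw : 0 < ‖w - c‖) (huw : u w = m)
    (hpos : ∀ x ∈ Ω, ‖x - c‖ ≤ ‖w - c‖ → x ≠ w → m < u x) : False := by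
  set R := ‖w - c‖ with hR
  obtain ⟨s₀, hs₀, hsΩ⟩ := Metric.nhds_basis_closedBall.mem_iff.1 (hΩ.mem_nhds hw)
  set s := min s₀ (R / 2) with hs
  have hspos : 0 < s := lt_min hs₀ (by positivity)
  have hDΩ : Metric.closedBall w s ⊆ Ω :=
    (Metric.closedBall_subset_closedBall (min_le_left _ _)).trans hsΩ
  have hDc : IsCompact (Metric.closedBall w s) := isCompact_closedBall w s
  obtain ⟨M, hM⟩ := hDc.bddAbove_image (hB.mono hDΩ)
  have hBM : ∀ x ∈ Metric.closedBall w s, B x ≤ M := fun x hx => hM ⟨x, hx, rfl⟩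
  have hrad : ∀ x ∈ Metric.closedBall w s, R / 2 ≤ ‖x - c‖ ∧ ‖x - c‖ ≤ 2 * R := by
    intro x hx
    rw [Metric.mem_closedBall, dist_eq_norm] at hx
    have hx' := hx.trans (min_le_right _ _)
    have h1 : ‖x - c‖ ≤ ‖x - w‖ + ‖w - c‖ := norm_sub_le_norm_sub_add_norm_sub _ _ _
    have h2 : ‖w - c‖ ≤ ‖w - x‖ + ‖x - c‖ := norm_sub_le_norm_sub_add_norm_sub _ _ _
    rw [norm_sub_rev w x] at h2
    constructor <;> linarith
  have hM0 : 0 ≤ M := by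
    obtain ⟨b, hb, -⟩ := hL w hw
    exact (norm_nonneg b).trans (hb.trans (hBM w (Metric.mem_closedBall_self hspos.le)))
  -- With `R/2 ≤ ‖x - c‖ ≤ 2R`, this makes `exp(-lam ‖x - c‖²)` a strict subsolution for every drift
  -- bounded by `M`.
  obtain ⟨lam, hlam0, hlam⟩ : ∃ lam : ℝ, 0 < lam ∧ N + 2 * M * R < R ^ 2 * lam / 2 := by
    refine ⟨2 * (N + 2 * M * R + 1) / R ^ 2, by positivity, ?_⟩
    field_simp
    linarith
  obtain ⟨ε, hε, hεu⟩ : ∃ ε > (0 : ℝ), ∀ x ∈ Metric.sphere w s, ‖x - c‖ ≤ R → m + ε ≤ u x := by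
    have hK : IsCompact (Metric.sphere w s ∩ {x | ‖x - c‖ ≤ R}) :=
      (isCompact_sphere w s).inter_right (isClosed_le (by fun_prop) continuous_const)
    have hKΩ : Metric.sphere w s ∩ {x | ‖x - c‖ ≤ R} ⊆ Ω := fun x hx =>
      hDΩ (Metric.sphere_subset_closedBall hx.1)
    rcases (Metric.sphere w s ∩ {x | ‖x - c‖ ≤ R}).eq_empty_or_nonempty with he | hne
    · refine ⟨1, one_pos, fun x hx hxc => ?_⟩
      have : x ∈ Metric.sphere w s ∩ {x | ‖x - c‖ ≤ R} := ⟨hx, hxc⟩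
      simp [he] at this
    · obtain ⟨x₁, hx₁, hmin⟩ := hK.exists_isMinOn hne (hu.continuousOn.mono hKΩ)
      refine ⟨u x₁ - m, sub_pos.2 (hpos x₁ (hKΩ hx₁) hx₁.2 ?_), fun x hx hxc => ?_⟩
      · rintro rfl
        have := hx₁.1
        simp [hspos.ne] at this
      · have := hmin (show x ∈ Metric.sphere w s ∩ {x | ‖x - c‖ ≤ R} from ⟨hx, hxc⟩)
        simp only [Set.mem_ofPred_eq] at this
        linarith
  set G : ℝ → ℝ := fun t => ε * Real.exp (-lam * t) with hG
  set g : EuclideanSpace ℝ (Fin N) → ℝ := fun y => u y - G (‖y - c‖ ^ 2) with hg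
  -- A minimizer on the sphere can be traded for `w`. Within distance `R` of `c`, `u` has gained
  -- `ε`, at least the size of the barrier; farther out, the barrier is smaller than at `w`.
  obtain ⟨x₀, hx₀, hmin₀⟩ : ∃ x₀ ∈ Metric.ball w s, IsMinOn g (Metric.closedBall w s) x₀ := by
    have hgc : ContinuousOn g (Metric.closedBall w s) :=
      (hu.continuousOn.mono hDΩ).sub (by fun_prop)
    obtain ⟨x₀, hx₀, hmin⟩ := hDc.exists_isMinOn ⟨w, Metric.mem_closedBall_self hspos.le⟩ hgc
    rcases (Metric.mem_closedBall.1 hx₀).lt_or_eq with h | h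
    · exact ⟨x₀, h, hmin⟩
    · refine ⟨w, Metric.mem_ball_self hspos, fun x hx => ?_⟩
      have h1 : g x₀ ≤ g x := hmin hx
      suffices g w ≤ g x₀ from this.trans h1
      simp only [hg, hG, huw, ← hR]
      rcases le_or_gt ‖x₀ - c‖ R with h2 | h2
      · have := hεu x₀ h h2
        have h3 : Real.exp (-lam * ‖x₀ - c‖ ^ 2) ≤ 1 := by
          rw [Real.exp_le_one_iff]
          have : 0 ≤ lam * ‖x₀ - c‖ ^ 2 := by positivity
          linarith
        have h4 := Real.exp_pos (-lam * R ^ 2)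
        nlinarith
      · have := hm x₀ (hDΩ hx₀)
        have h3 : Real.exp (-lam * ‖x₀ - c‖ ^ 2) ≤ Real.exp (-lam * R ^ 2) := by
          rw [Real.exp_le_exp]
          have : R ^ 2 ≤ ‖x₀ - c‖ ^ 2 := by gcongr
          nlinarith
        nlinarith
  have hx₀' := Metric.ball_subset_closedBall hx₀
  have hloc : IsLocalMin g x₀ := hmin₀.isLocalMin
    (Filter.mem_of_superset (Metric.isOpen_ball.mem_nhds hx₀) Metric.ball_subset_closedBall)
  have hder : ∀ (a t : ℝ), HasDerivAt (fun t => a * Real.exp (-lam * t))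
      (a * -lam * Real.exp (-lam * t)) t := fun a t => by
    have h1 : HasDerivAt (fun t => -lam * t) (-lam) t := by
      simpa using (hasDerivAt_id t).const_mul (-lam)
    refine (h1.exp.const_mul a).congr_deriv ?_
    ring
  obtain ⟨h1, h2⟩ := touching_below hΩ hu (hDΩ hx₀')
    (Filter.Eventually.of_forall fun t => hder ε t) (hder (ε * -lam) _) hloc
  obtain ⟨b, hb, hLb⟩ := hL x₀ (hDΩ hx₀')
  set r := ‖x₀ - c‖ with hr
  set e := Real.exp (-lam * r ^ 2)
  have he : 0 < e := Real.exp_pos _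
  rw [h1, real_inner_smul_right] at hLb
  have hbi : ⟪b, x₀ - c⟫ ≤ M * r :=
    (real_inner_le_norm _ _).trans
      (mul_le_mul_of_nonneg_right (hb.trans (hBM x₀ hx₀')) (norm_nonneg _))
  obtain ⟨hr1, hr2⟩ := hrad x₀ hx₀'
  have hk : 0 < 2 * ε * lam * e := by positivity
  have h3 : (2 * ε * lam * e) * (2 * r ^ 2 * lam - N - M * r) ≤ 0 := by
    have := mul_le_mul_of_nonneg_left hbi hk.le
    nlinarith
  have h4 : R ^ 2 / 4 ≤ r ^ 2 := by nlinarith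
  have h5 : M * r ≤ M * (2 * R) := by gcongr
  have h6 : R ^ 2 / 4 * lam ≤ r ^ 2 * lam := by gcongr
  have : 0 < 2 * r ^ 2 * lam - N - M * r := by linarith
  exact absurd h3 (not_le.2 (mul_pos hk this))

/-- Halving the ball about `y` through `w` leaves `w` as the only point of contact, as the barrier
step requires. -/
theorem norm_sub_lt_of_mem_inner_ball {y w x : EuclideanSpace ℝ (Fin N)}
    (hx : ‖x - midpoint ℝ y w‖ ≤ ‖w - midpoint ℝ y w‖) (hne : x ≠ w) : ‖x - y‖ < ‖w - y‖ := by
  have hc : midpoint ℝ y w = (1 / 2 : ℝ) • (y + w) := by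
    rw [midpoint_eq_smul_add]; simp
  set c := midpoint ℝ y w
  have h := parallelogram_law_with_norm ℝ (x - c) (w - c)
  have e1 : (x - c) + (w - c) = x - y := by rw [hc]; module
  have e2 : (x - c) - (w - c) = x - w := by abel
  have e3 : w - y = (2 : ℝ) • (w - c) := by rw [hc]; module
  rw [e1, e2] at h
  have h4 : ‖w - y‖ = 2 * ‖w - c‖ := by rw [e3, norm_smul]; simp
  have h5 : 0 < ‖x - w‖ := norm_pos_iff.2 (sub_ne_zero.2 hne)
  rw [h4]
  refine lt_of_pow_lt_pow_left₀ 2 (by positivity) ?_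
  nlinarith [norm_nonneg (x - c)]

/-- Strong maximum principle for `Δ + b·∇` with a locally bounded drift. -/
theorem strong_maximum_principle {Ω : Set (EuclideanSpace ℝ (Fin N))} (hΩ : IsOpen Ω)
    (hconn : IsPreconnected Ω)
    {u B : EuclideanSpace ℝ (Fin N) → ℝ} (hu : ContDiffOn ℝ 2 u Ω) (hB : ContinuousOn B Ω)
    (hL : ∀ x ∈ Ω, ∃ b : EuclideanSpace ℝ (Fin N), ‖b‖ ≤ B x ∧
      divergence (gradient u) x + ⟪b, gradient u x⟫ ≤ 0)
    {m : ℝ} (hm : ∀ x ∈ Ω, m ≤ u x) {z : EuclideanSpace ℝ (Fin N)} (hz : z ∈ Ω) (huz : u z = m) :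
    ∀ x ∈ Ω, u x = m := by
  have hopen : IsOpen {x ∈ Ω | u x = m} := by
    rw [Metric.isOpen_iff]
    rintro z ⟨hz, huz⟩
    obtain ⟨ρ, hρ, hρΩ⟩ := Metric.nhds_basis_closedBall.mem_iff.1 (hΩ.mem_nhds hz)
    -- A point closer to `y` than the nearest contact point `w` lies within `2‖y - z‖ < ρ` of `z`,
    -- hence in the ball where `w` was selected.
    refine ⟨ρ / 2, by positivity, fun y hy => ?_⟩
    have hyρ : y ∈ Metric.closedBall z ρ := by
      rw [Metric.mem_ball] at hy
      rw [Metric.mem_closedBall]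
      linarith
    refine ⟨hρΩ hyρ, ?_⟩
    by_contra huy
    have hK : IsCompact (Metric.closedBall z ρ ∩ u ⁻¹' {m}) :=
      (isCompact_closedBall z ρ).of_isClosed_subset
        ((hu.continuousOn.mono hρΩ).preimage_isClosed_of_isClosed Metric.isClosed_closedBall
          isClosed_singleton) Set.inter_subset_left
    have hzK : z ∈ Metric.closedBall z ρ ∩ u ⁻¹' {m} := ⟨Metric.mem_closedBall_self hρ.le, huz⟩
    obtain ⟨w, hwK, hw⟩ := hK.exists_infDist_eq_dist ⟨z, hzK⟩ y
    have hwy : ∀ x ∈ Metric.closedBall z ρ ∩ u ⁻¹' {m}, ‖w - y‖ ≤ ‖x - y‖ := fun x hx => by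
      have := Metric.infDist_le_dist_of_mem (x := y) hx
      rwa [hw, dist_comm, dist_comm y x, dist_eq_norm, dist_eq_norm] at this
    have hyw : w ≠ y := fun h => huy (h ▸ hwK.2)
    refine not_min_on_touching_ball hΩ hu hB hL hm (c := midpoint ℝ y w) (hρΩ hwK.1) ?_ hwK.2
      fun x hxΩ hx hxw => ?_
    · rw [norm_pos_iff, sub_ne_zero]
      intro h
      exact hyw ((right_eq_midpoint_iff (R := ℝ)).1 h).symm
    · have hlt := norm_sub_lt_of_mem_inner_ball hx hxw
      refine lt_of_le_of_ne (hm x hxΩ) fun h => ?_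
      refine absurd (hwy x ⟨?_, h.symm⟩) (not_le.2 hlt)
      have h1 := hwy z hzK
      rw [Metric.mem_ball, dist_eq_norm, norm_sub_rev] at hy
      have h2 : ‖x - z‖ ≤ ‖x - y‖ + ‖y - z‖ := norm_sub_le_norm_sub_add_norm_sub _ _ _
      rw [norm_sub_rev y z] at h2
      rw [Metric.mem_closedBall, dist_eq_norm]
      linarith
  have hopen' : IsOpen {x ∈ Ω | u x ≠ m} :=
    hu.continuousOn.isOpen_inter_preimage hΩ isOpen_compl_singleton
  intro x hx
  by_contra hux
  obtain ⟨y, -, h1, h2⟩ := hconn _ _ hopen hopen'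
    (fun y hy => (em (u y = m)).imp (fun h => ⟨hy, h⟩) fun h => ⟨hy, h⟩)
    ⟨z, hz, hz, huz⟩ ⟨x, hx, hx, hux⟩
  exact h2.2 h1.2

/-- The drift `β (x - p)/d²` has norm `|β|/d`, which is locally bounded. An interior minimum would
make `u` constant, forcing `f = 0`; so the minimum is attained only on the boundary, where `u = 0`.
-/
theorem IsSolution.pos {Ω : Set (EuclideanSpace ℝ (Fin N))} (hΩ : IsOpen Ω)
    (hconn : IsConnected Ω) (hb : Bornology.IsBounded Ω) (hne : (frontier Ω).Nonempty) {β : ℝ}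
    {f u : EuclideanSpace ℝ (Fin N) → ℝ} (hf : ContinuousOn f (closure Ω))
    (hf0 : ∀ x ∈ Ω, 0 ≤ f x) (hfne : ∃ x ∈ Ω, f x ≠ 0)
    (hu : IsSolution Ω β f u) {x : EuclideanSpace ℝ (Fin N)} (hx : x ∈ Ω) : 0 < u x := by
  have hd : ∀ x ∈ Ω, bdist Ω x ≠ 0 := fun x hx => (bdist_pos hΩ hne hx).ne'
  have hL : ∀ x ∈ Ω, ∃ b : EuclideanSpace ℝ (Fin N), ‖b‖ ≤ |β| / bdist Ω x ∧
      divergence (gradient u) x + ⟪b, gradient u x⟫ ≤ 0 := fun x hx => by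
    obtain ⟨p, -, hxp, h⟩ := hu.nondivergence hΩ hb hne hf hx
    have hpos := bdist_pos hΩ hne hx
    refine ⟨(β / bdist Ω x ^ 2) • (x - p), ?_, ?_⟩
    · rw [norm_smul, hxp, Real.norm_eq_abs, abs_div, abs_of_pos (pow_pos hpos 2)]
      apply le_of_eq
      field_simp
    · rw [real_inner_smul_left, h]
      have := mul_nonneg (hf0 x hx) (Real.rpow_nonneg hpos.le (-β))
      linarith
  have hBc : ContinuousOn (fun x => |β| / bdist Ω x) Ω :=
    continuousOn_const.div (continuous_bdist Ω).continuousOn hd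
  obtain ⟨z, hz, hmin⟩ := hb.isCompact_closure.exists_isMinOn hconn.nonempty.closure hu.continuousOn
  have hm : ∀ x ∈ Ω, u z ≤ u x := fun x hx => hmin (subset_closure hx)
  have key : ∀ y ∈ Ω, u y ≠ u z := by
    intro y hy huy
    have hconst := strong_maximum_principle hΩ hconn.isPreconnected hu.contDiffOn hBc hL hm hy huy
    obtain ⟨x₁, hx₁, hfx₁⟩ := hfne
    have hg : ∀ x ∈ Ω, gradient u x = 0 := fun x hx => by
      have : u =ᶠ[𝓝 x] fun _ => u z := by
        filter_upwards [hΩ.mem_nhds hx] with v hv using hconst v hv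
      rw [this.gradient.self_of_nhds]
      simp [gradient]
    have hdv : divergence (gradient u) x₁ = 0 := by
      have : gradient u =ᶠ[𝓝 x₁] fun _ => 0 := by
        filter_upwards [hΩ.mem_nhds hx₁] with v hv using hg v hv
      simp [divergence, this.fderiv_eq]
    obtain ⟨p, -, -, h⟩ := hu.nondivergence hΩ hb hne hf hx₁
    have := Real.rpow_pos_of_pos (bdist_pos hΩ hne hx₁) (-β)
    rw [hdv, hg x₁ hx₁, inner_zero_right, mul_zero, add_zero] at h
    rcases mul_eq_zero.1 (neg_eq_zero.1 h.symm) with h | h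
    · exact hfx₁ h
    · exact this.ne' h
  have hzf : z ∈ frontier Ω := by
    rw [hΩ.frontier_eq]
    exact ⟨hz, fun h => key z h rfl⟩
  rw [← hu.boundary z hzf]
  exact lt_of_le_of_ne (hm x hx) (key x hx).symm

/-! ### Uniform interior and exterior balls -/

theorem exists_mem_frontier_of_isPreconnected {X : Type*} [TopologicalSpace X] {s Ω : Set X}
    (hs : IsPreconnected s) (hΩ : IsOpen Ω) {x y : X} (hx : x ∈ s) (hxΩ : x ∈ Ω) (hy : y ∈ s)
    (hyΩ : y ∉ Ω) : ∃ z ∈ s, z ∈ frontier Ω := by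
  by_contra! h
  have hcl : ∀ z ∈ s, z ∉ Ω → z ∈ (closure Ω)ᶜ := fun z hz hzΩ hzc =>
    h z hz (hΩ.frontier_eq ▸ ⟨hzc, hzΩ⟩)
  obtain ⟨z, -, hz, hz'⟩ := hs Ω (closure Ω)ᶜ hΩ isClosed_closure.isOpen_compl
    (fun z hz => (em (z ∈ Ω)).imp id (hcl z hz)) ⟨x, hx, hxΩ⟩ ⟨y, hy, hcl y hy hyΩ⟩
  exact hz' (subset_closure hz)

theorem ball_bdist_subset {Ω : Set (EuclideanSpace ℝ (Fin N))} (hΩ : IsOpen Ω) {x : EuclideanSpace ℝ (Fin N)}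
    (hx : x ∈ Ω) : Metric.ball x (bdist Ω x) ⊆ Ω := by
  intro y hy
  by_contra hyΩ
  have hpos : 0 < bdist Ω x := dist_nonneg.trans_lt (Metric.mem_ball.1 hy)
  obtain ⟨z, hz, hzf⟩ := exists_mem_frontier_of_isPreconnected
    (convex_ball x (bdist Ω x)).isPreconnected hΩ (Metric.mem_ball_self hpos) hx hy hyΩ
  have := bdist_le_norm_sub hzf x
  rw [Metric.mem_ball, dist_eq_norm, norm_sub_rev] at hz
  linarith

/-- Data of a `C²` defining function near a boundary point, with uniform constants. -/
theorem HasC2Boundary.exists_local_taylor {Ω : Set (EuclideanSpace ℝ (Fin N))}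
    (hC2 : HasC2Boundary Ω) (hΩ : IsOpen Ω) {p₀ : EuclideanSpace ℝ (Fin N)}
    (hp₀ : p₀ ∈ frontier Ω) :
    ∃ δ > (0 : ℝ), ∃ m > (0 : ℝ), ∃ L ≥ (0 : ℝ),
      ∃ (ρ : EuclideanSpace ℝ (Fin N) → ℝ) (g : EuclideanSpace ℝ (Fin N) → EuclideanSpace ℝ (Fin N)),
        ∀ p ∈ frontier Ω, ‖p - p₀‖ < δ → m ≤ ‖g p‖ ∧ ∀ y, ‖y - p‖ < δ →
          (y ∈ Ω ↔ ρ y < 0) ∧ |ρ y - ⟪g p, y - p⟫| ≤ L * ‖y - p‖ ^ 2 := by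
  obtain ⟨U, ρ, hU, hpU, hρ, hρ', hΩU⟩ := hC2 p₀ hp₀
  have hgC := contDiffOn_gradient hU hρ
  obtain ⟨L, t, ht, hLip⟩ := (hgC.contDiffAt (hU.mem_nhds hpU)).exists_lipschitzOnWith
  have hg0 : 0 < ‖gradient ρ p₀‖ := by
    rw [norm_pos_iff]
    intro h
    exact hρ' ((LinearIsometryEquiv.map_eq_zero_iff _).1 h)
  have hev : ∀ᶠ y in 𝓝 p₀, y ∈ U ∧ y ∈ t ∧ ‖gradient ρ p₀‖ / 2 < ‖gradient ρ y‖ :=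
    Filter.Eventually.and (hU.mem_nhds hpU) (Filter.Eventually.and ht
      ((hgC.continuousOn.continuousAt (hU.mem_nhds hpU)).norm.eventually
        (lt_mem_nhds (half_lt_self hg0))))
  obtain ⟨δ, hδ, hball⟩ := Metric.eventually_nhds_iff.1 hev
  refine ⟨δ / 2, half_pos hδ, ‖gradient ρ p₀‖ / 2, half_pos hg0, L, L.2, ρ, gradient ρ, ?_⟩
  intro p hp hpp₀
  have hnear : ∀ z, ‖z - p‖ < δ / 2 → dist z p₀ < δ := fun z hz => by
    have := norm_sub_le_norm_sub_add_norm_sub z p p₀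
    rw [dist_eq_norm]
    linarith
  obtain ⟨hpU', hpt, hgp⟩ := hball (hnear p (by simpa using half_pos hδ))
  have hmem : ∀ y ∈ U, (y ∈ Ω ↔ ρ y < 0) := fun y hy => by
    have := Set.ext_iff.1 hΩU y
    simpa [hy] using this
  have hρp : ρ p = 0 := by
    rw [hΩ.frontier_eq] at hp
    refine le_antisymm ?_ (not_lt.1 fun h => hp.2 ((hmem p hpU').2 h))
    by_contra! h
    have hnb : ∀ᶠ y in 𝓝 p, y ∈ U ∧ 0 < ρ y := Filter.Eventually.and (hU.mem_nhds hpU')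
      ((hρ.continuousOn.continuousAt (hU.mem_nhds hpU')).eventually (lt_mem_nhds h))
    obtain ⟨y, ⟨hyU, hy⟩, hyΩ⟩ := mem_closure_iff_nhds.1 hp.1 _ hnb
    exact absurd ((hmem y hyU).1 hyΩ) (not_lt.2 hy.le)
  refine ⟨hgp.le, fun y hy => ⟨hmem y (hball (hnear y hy)).1, ?_⟩⟩
  have hsub : ∀ z ∈ Metric.closedBall p ‖y - p‖, z ∈ U ∧ z ∈ t ∧ ‖z - p‖ ≤ ‖y - p‖ := fun z hz => by
    rw [Metric.mem_closedBall, dist_eq_norm] at hz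
    have := hball (hnear z (hz.trans_lt hy))
    exact ⟨this.1, this.2.1, hz⟩
  have hd : ∀ z ∈ Metric.closedBall p ‖y - p‖, HasFDerivWithinAt ρ
      (InnerProductSpace.toDual ℝ _ (gradient ρ z)) (Metric.closedBall p ‖y - p‖) z := fun z hz =>
    ((hρ.differentiableOn two_ne_zero).differentiableAt
      (hU.mem_nhds (hsub z hz).1)).hasGradientAt.hasFDerivAt.hasFDerivWithinAt
  -- Mean value inequality for `ρ` minus its linearization at `p`; the Lipschitz gradient makes the
  -- remainder quadratic.
  have := (convex_closedBall p ‖y - p‖).norm_image_sub_le_of_norm_hasFDerivWithin_le'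
    (φ := InnerProductSpace.toDual ℝ _ (gradient ρ p)) (C := L * ‖y - p‖) hd (fun z hz => by
      rw [← map_sub, LinearIsometryEquiv.norm_map]
      have h1 := hLip.norm_sub_le (hsub z hz).2.1 hpt
      exact h1.trans (mul_le_mul_of_nonneg_left (hsub z hz).2.2 L.2))
    (Metric.mem_closedBall_self (norm_nonneg _)) (y := y) (by simp [dist_eq_norm])
  rw [hρp, sub_zero, InnerProductSpace.toDual_apply_apply, Real.norm_eq_abs] at this
  linarith

/-- At a nearest boundary point, the direction to the interior is opposite to the gradient of a
defining function. -/
theorem inner_normal_le_neg_one {δ m L : ℝ} {x p g ν n : EuclideanSpace ℝ (Fin N)} {d : ℝ}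
    {ρ : EuclideanSpace ℝ (Fin N) → ℝ} (hδ : 0 < δ) (hm : 0 < m) (hL : 0 ≤ L) (hd : 0 < d)
    (hν : ‖ν‖ = 1) (hn : ‖n‖ = 1) (hx : x = p + d • ν) (hg : g = ‖g‖ • n) (hgm : m ≤ ‖g‖)
    (htaylor : ∀ y, ‖y - p‖ < δ → |ρ y - ⟪g, y - p⟫| ≤ L * ‖y - p‖ ^ 2)
    (hneg : ∀ y, ‖y - p‖ < δ → ‖y - x‖ < d → ρ y < 0) : ⟪ν, n⟫ ≤ -1 := by
  by_contra! h
  -- If `⟪ν, n⟫ > -1`, moving from `p` along `v` enters the ball about `x`, where `ρ < 0`, yet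
  -- increases `ρ` to first order: a contradiction for small `t`.
  set v := ν + n with hv
  set a := 1 + ⟪ν, n⟫ with ha
  have hapos : 0 < a := by linarith
  have hnv : ⟪n, v⟫ = a := by
    rw [hv, inner_add_right, real_inner_self_eq_norm_sq, hn, real_inner_comm]; ring
  have hνv : ⟪ν, v⟫ = a := by
    rw [hv, inner_add_right, real_inner_self_eq_norm_sq, hν]; ring
  have hvv : ‖v‖ ^ 2 = 2 * a := by
    rw [hv, norm_add_sq_real, hν, hn, ha]; ring
  have hv2 : ‖v‖ ≤ 2 := by
    calc ‖v‖ ≤ ‖ν‖ + ‖n‖ := norm_add_le _ _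
      _ = 2 := by rw [hν, hn]; norm_num
  obtain ⟨t, ht0, htd, htδ, htm⟩ : ∃ t > (0 : ℝ), t < d ∧ t * 2 < δ ∧ 2 * L * t < m := by
    have hq : 0 < m / (2 * L + 1) := by positivity
    have hmin : 0 < min d (min (δ / 2) (m / (2 * L + 1))) := lt_min hd (lt_min (half_pos hδ) hq)
    refine ⟨min d (min (δ / 2) (m / (2 * L + 1))) / 2, half_pos hmin, ?_, ?_, ?_⟩
    · linarith [min_le_left d (min (δ / 2) (m / (2 * L + 1)))]
    · linarith [min_le_right d (min (δ / 2) (m / (2 * L + 1))),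
        min_le_left (δ / 2) (m / (2 * L + 1))]
    · have h1 : min d (min (δ / 2) (m / (2 * L + 1))) ≤ m / (2 * L + 1) :=
        (min_le_right _ _).trans (min_le_right _ _)
      rw [le_div_iff₀ (by positivity)] at h1
      nlinarith
  have hyp : p + t • v - p = t • v := by abel
  have hnorm : ‖p + t • v - p‖ = t * ‖v‖ := by
    rw [hyp, norm_smul, Real.norm_of_nonneg ht0.le]
  have hyδ : ‖p + t • v - p‖ < δ := by
    rw [hnorm]
    exact (mul_le_mul_of_nonneg_left hv2 ht0.le).trans_lt htδ
  have h1 := htaylor _ hyδ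
  have h2 := hneg _ hyδ (by
    refine lt_of_pow_lt_pow_left₀ 2 hd.le ?_
    have : p + t • v - x = t • v - d • ν := by rw [hx]; abel
    rw [this, norm_sub_sq_real, norm_smul, norm_smul, hν, real_inner_smul_left,
      real_inner_smul_right, real_inner_comm, hνv, mul_pow, hvv, Real.norm_eq_abs,
      Real.norm_eq_abs, mul_pow, sq_abs, sq_abs]
    have : 0 < t * a * (d - t) := mul_pos (mul_pos ht0 hapos) (sub_pos.2 htd)
    nlinarith)
  rw [hnorm, hyp, real_inner_smul_right, hg, real_inner_smul_left, hnv, mul_pow, hvv] at h1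
  have h3 := (abs_le.1 h1).1
  have h4 : 0 < t * a * (‖g‖ - 2 * L * t) := mul_pos (mul_pos ht0 hapos) (by linarith)
  nlinarith

/-- In a ball of radius `r` tangent at `p` with axis `ν'`, `‖y - p‖² < 2r ⟪ν', y - p⟫`. Once `2rL <
m`, the linear part of `ρ` beats the Taylor remainder and fixes the sign of `ρ`. -/
theorem HasC2Boundary.exists_local_balls {Ω : Set (EuclideanSpace ℝ (Fin N))}
    (hC2 : HasC2Boundary Ω) (hΩ : IsOpen Ω) {p₀ : EuclideanSpace ℝ (Fin N)}
    (hp₀ : p₀ ∈ frontier Ω) :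
    ∃ δ > (0 : ℝ), ∃ r₀ > (0 : ℝ), ∀ r > 0, r ≤ r₀ → ∀ p ∈ frontier Ω, ‖p - p₀‖ < δ →
      ∀ (ν : EuclideanSpace ℝ (Fin N)) (d : ℝ), 0 < d → ‖ν‖ = 1 → p + d • ν ∈ Ω →
        bdist Ω (p + d • ν) = d →
        (∀ y, ‖y - (p + r • ν)‖ < r → y ∈ Ω) ∧ (∀ y, ‖y - (p - r • ν)‖ < r → y ∉ Ω) := by
  obtain ⟨δ, hδ, m, hm, L, hL, ρ, g, h⟩ := hC2.exists_local_taylor hΩ hp₀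
  refine ⟨δ, hδ, min (δ / 2) (m / (2 * (L + 1))), lt_min (half_pos hδ) (by positivity), ?_⟩
  intro r hr hrr p hp hpp ν d hd hν hx hdx
  obtain ⟨hgm, hy⟩ := h p hp hpp
  have hg0 : 0 < ‖g p‖ := hm.trans_le hgm
  set n := ‖g p‖⁻¹ • g p with hn
  have hn1 : ‖n‖ = 1 := by
    rw [hn, norm_smul, norm_inv, norm_norm, inv_mul_cancel₀ hg0.ne']
  have hgn : g p = ‖g p‖ • n := by rw [hn, smul_inv_smul₀ hg0.ne']
  have hνn := inner_normal_le_neg_one hδ hm hL hd hν hn1 rfl hgn hgm (fun y h => (hy y h).2)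
    (fun y h1 h2 => (hy y h1).1.1 (ball_bdist_subset hΩ hx (by
      rwa [hdx, Metric.mem_ball, dist_eq_norm])))
  have hνeq : n = -ν := by
    have : ‖n + ν‖ ^ 2 ≤ 0 := by
      rw [norm_add_sq_real, hν, hn1, real_inner_comm]; linarith
    have : ‖n + ν‖ = 0 := by nlinarith [norm_nonneg (n + ν)]
    exact eq_neg_of_add_eq_zero_left (norm_eq_zero.1 this)
  have hrδ : 2 * r ≤ δ := by linarith [hrr.trans (min_le_left _ _)]
  have hrm : 2 * r * L < m := by
    have h1 := hrr.trans (min_le_right _ _)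
    rw [le_div_iff₀ (by positivity)] at h1
    nlinarith
  have hin : ∀ y, ⟪g p, y - p⟫ = -(‖g p‖ * ⟪ν, y - p⟫) := fun y => by
    conv_lhs => rw [hgn, real_inner_smul_left, hνeq, inner_neg_left]
    ring
  have hball : ∀ (y ν' : EuclideanSpace ℝ (Fin N)), ‖ν'‖ = 1 → ‖y - (p + r • ν')‖ < r →
      ‖y - p‖ < δ ∧ L * ‖y - p‖ ^ 2 < ‖g p‖ * ⟪ν', y - p⟫ := by
    intro y ν' hν' hyr
    have h1 : ‖y - p‖ < δ := by
      have : y - p = (y - (p + r • ν')) + r • ν' := by abel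
      have h2 := norm_add_le (y - (p + r • ν')) (r • ν')
      rw [← this, norm_smul, hν', Real.norm_of_nonneg hr.le] at h2
      linarith
    refine ⟨h1, ?_⟩
    have h2 : ‖y - (p + r • ν')‖ ^ 2 < r ^ 2 := by gcongr
    have h3 : y - (p + r • ν') = (y - p) - r • ν' := by abel
    rw [h3, norm_sub_sq_real, norm_smul, hν', Real.norm_of_nonneg hr.le, real_inner_smul_right,
      real_inner_comm] at h2
    have h4 : ‖y - p‖ ^ 2 < 2 * r * ⟪ν', y - p⟫ := by linarith
    have h5 : 0 < ⟪ν', y - p⟫ := by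
      have : 0 < 2 * r * ⟪ν', y - p⟫ := (sq_nonneg _).trans_lt h4
      exact pos_of_mul_pos_right this (by positivity)
    calc L * ‖y - p‖ ^ 2 ≤ L * (2 * r * ⟪ν', y - p⟫) := by gcongr
      _ = 2 * r * L * ⟪ν', y - p⟫ := by ring
      _ < ‖g p‖ * ⟪ν', y - p⟫ := by
        apply mul_lt_mul_of_pos_right _ h5
        linarith
  constructor
  · intro y hyr
    obtain ⟨h1, h2⟩ := hball y ν hν hyr
    obtain ⟨h3, h4⟩ := hy y h1
    rw [h3]
    rw [hin] at h4
    linarith [(abs_le.1 h4).2]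
  · intro y hyr
    have e : p - r • ν = p + r • (-ν) := by rw [smul_neg, sub_eq_add_neg]
    rw [e] at hyr
    obtain ⟨h1, h2⟩ := hball y (-ν) (by rwa [norm_neg]) hyr
    obtain ⟨h3, h4⟩ := hy y h1
    rw [h3, not_lt]
    rw [hin] at h4
    rw [inner_neg_left] at h2
    linarith [(abs_le.1 h4).1]

/-- Uniform interior and exterior ball condition for bounded open sets with `C²` boundary. -/
theorem HasC2Boundary.exists_uniform_balls {Ω : Set (EuclideanSpace ℝ (Fin N))}
    (hC2 : HasC2Boundary Ω) (hΩ : IsOpen Ω) (hb : Bornology.IsBounded Ω) :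
    ∃ r > (0 : ℝ), ∀ p ∈ frontier Ω,
      ∀ (ν : EuclideanSpace ℝ (Fin N)) (d : ℝ), 0 < d → ‖ν‖ = 1 → p + d • ν ∈ Ω →
        bdist Ω (p + d • ν) = d →
        (∀ y, ‖y - (p + r • ν)‖ < r → y ∈ Ω) ∧ (∀ y, ‖y - (p - r • ν)‖ < r → y ∉ Ω) := by
  -- Allowing all `r ≤ r₀` lets the smaller of two radii serve a union. The repeated membership
  -- arises because compact induction replaces the first occurrence by an arbitrary set.
  have key : ∃ r₀ > (0 : ℝ), ∀ r > 0, r ≤ r₀ → ∀ p ∈ frontier Ω, p ∈ frontier Ω →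
      ∀ (ν : EuclideanSpace ℝ (Fin N)) (d : ℝ), 0 < d → ‖ν‖ = 1 → p + d • ν ∈ Ω →
        bdist Ω (p + d • ν) = d →
        (∀ y, ‖y - (p + r • ν)‖ < r → y ∈ Ω) ∧ (∀ y, ‖y - (p - r • ν)‖ < r → y ∉ Ω) := by
    refine (isCompact_frontier_of_isBounded hb).induction_on
      (p := fun s => ∃ r₀ > (0 : ℝ), ∀ r > 0, r ≤ r₀ → ∀ p ∈ s, p ∈ frontier Ω →
        ∀ (ν : EuclideanSpace ℝ (Fin N)) (d : ℝ), 0 < d → ‖ν‖ = 1 → p + d • ν ∈ Ω →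
        bdist Ω (p + d • ν) = d →
        (∀ y, ‖y - (p + r • ν)‖ < r → y ∈ Ω) ∧ (∀ y, ‖y - (p - r • ν)‖ < r → y ∉ Ω))
      ⟨1, one_pos, by simp⟩ ?_ ?_ ?_
    · rintro s t hst ⟨r₀, h0, h⟩
      exact ⟨r₀, h0, fun r hr hrr p hp => h r hr hrr p (hst hp)⟩
    · rintro s t ⟨r₁, h1, hs⟩ ⟨r₂, h2, ht⟩
      refine ⟨min r₁ r₂, lt_min h1 h2, fun r hr hrr p hp => ?_⟩
      rcases hp with hp | hp
      · exact hs r hr (hrr.trans (min_le_left _ _)) p hp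
      · exact ht r hr (hrr.trans (min_le_right _ _)) p hp
    · intro p₀ hp₀
      obtain ⟨δ, hδ, r₀, hr₀, h⟩ := hC2.exists_local_balls hΩ hp₀
      refine ⟨Metric.ball p₀ δ, mem_nhdsWithin_of_mem_nhds (Metric.ball_mem_nhds p₀ hδ), r₀, hr₀,
        fun r hr hrr p hp hpf => h r hr hrr p hpf ?_⟩
      rwa [Metric.mem_ball, dist_eq_norm] at hp
  obtain ⟨r₀, h0, h⟩ := key
  exact ⟨r₀, h0, fun p hp => h r₀ h0 le_rfl p hp hp⟩

/-- The segment from `y` to `q` crosses the boundary before entering the ball. -/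
theorem bdist_le_of_exterior_ball {Ω : Set (EuclideanSpace ℝ (Fin N))} (hΩ : IsOpen Ω)
    {q y : EuclideanSpace ℝ (Fin N)} {r : ℝ} (hr : 0 < r) (hq : ∀ z, ‖z - q‖ < r → z ∉ Ω)
    (hy : y ∈ Ω) : bdist Ω y ≤ ‖y - q‖ - r := by
  obtain ⟨z, hz, hzf⟩ := exists_mem_frontier_of_isPreconnected
    (convex_segment (𝕜 := ℝ) y q).isPreconnected hΩ (left_mem_segment ℝ y q) hy
    (right_mem_segment ℝ y q) (hq q (by simpa using hr))
  have h1 := dist_add_dist_of_mem_segment hz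
  have h2 : r ≤ ‖z - q‖ := by
    by_contra! h
    obtain ⟨v, hv, hvΩ⟩ := mem_closure_iff_nhds.1 (frontier_subset_closure hzf) _
      (Metric.isOpen_ball.mem_nhds (show z ∈ Metric.ball q r by
        rwa [Metric.mem_ball, dist_eq_norm]))
    rw [Metric.mem_ball, dist_eq_norm] at hv
    exact hq v hv hvΩ
  rw [dist_eq_norm, dist_eq_norm, dist_eq_norm] at h1
  linarith [bdist_le_norm_sub hzf y]

theorem le_bdist_of_interior_ball {Ω : Set (EuclideanSpace ℝ (Fin N))} (hΩ : IsOpen Ω)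
    (hne : (frontier Ω).Nonempty)
    {q : EuclideanSpace ℝ (Fin N)} {r : ℝ} (hq : ∀ z, ‖z - q‖ < r → z ∈ Ω)
    (y : EuclideanSpace ℝ (Fin N)) : r - ‖y - q‖ ≤ bdist Ω y := by
  refine (Metric.le_infDist hne).2 fun z hz => ?_
  rw [hΩ.frontier_eq] at hz
  have h1 : r ≤ ‖z - q‖ := not_lt.1 fun h => hz.2 (hq z h)
  have h2 := norm_sub_le_norm_sub_add_norm_sub z y q
  rw [dist_eq_norm, norm_sub_rev y z]
  linarith

/-! ### Contact of a solution with a function of the distance -/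

/-- Here `s` stands for `‖y - q‖²`, and `κ (√s - r)` is the distance to the sphere: `κ = 1` for an
exterior ball, `κ = -1` for an interior one. -/
theorem eventually_hasDerivAt_radial {φ φ1 : ℝ → ℝ} {κ r d R : ℝ} (hR : 0 < R)
    (hd : κ * (R - r) = d) (hφ : ∀ᶠ t in 𝓝 d, HasDerivAt φ (φ1 t) t) :
    ∀ᶠ s in 𝓝 (R ^ 2), HasDerivAt (fun s => φ (κ * (√s - r)))
      (φ1 (κ * (√s - r)) * (κ * (1 / (2 * √s)))) s := by
  have hc : Tendsto (fun s : ℝ => κ * (√s - r)) (𝓝 (R ^ 2)) (𝓝 d) := by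
    have : Continuous fun s : ℝ => κ * (√s - r) := by fun_prop
    have h := this.tendsto (R ^ 2)
    rwa [Real.sqrt_sq hR.le, hd] at h
  filter_upwards [hc.eventually hφ, lt_mem_nhds (show 0 < R ^ 2 by positivity)] with s hs hs0
  exact hs.comp s (((Real.hasDerivAt_sqrt hs0.ne').sub_const r).const_mul κ)

theorem hasDerivAt_radial_deriv {φ1 : ℝ → ℝ} {φ2 κ r d R : ℝ} (hκ : κ ^ 2 = 1) (hR : 0 < R)
    (hd : κ * (R - r) = d) (hφ1 : HasDerivAt φ1 φ2 d) :
    HasDerivAt (fun s => φ1 (κ * (√s - r)) * (κ * (1 / (2 * √s))))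
      (φ2 / (4 * R ^ 2) - κ * φ1 d / (4 * R ^ 3)) (R ^ 2) := by
  have hR2 : R ^ 2 ≠ 0 := by positivity
  have hs := Real.hasDerivAt_sqrt hR2
  have h1 : HasDerivAt (fun s => φ1 (κ * (√s - r))) (φ2 * (κ * (1 / (2 * √(R ^ 2))))) (R ^ 2) := by
    refine HasDerivAt.comp (R ^ 2) (h₂ := φ1) ?_ ((hs.sub_const r).const_mul κ)
    rwa [Real.sqrt_sq hR.le, hd]
  have h2 := ((hs.const_mul 2).fun_inv (by positivity)).const_mul κ
  have h3 := h1.fun_mul h2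
  simp only [← one_div] at h3
  refine h3.congr_deriv ?_
  rw [Real.sqrt_sq hR.le, hd]
  field_simp
  linear_combination φ2 * R * 4 * hκ

section Contact

variable {Ω : Set (EuclideanSpace ℝ (Fin N))} {β r : ℝ} {f u : EuclideanSpace ℝ (Fin N) → ℝ}

/-- If `φ ∘ d` touches a solution from above at `x`, then `φ ∘ d` is a subsolution there up to the
curvature term coming from an exterior ball of radius `r`. -/
theorem IsSolution.contact_above (hu : IsSolution Ω β f u) (hΩ : IsOpen Ω)
    (hb : Bornology.IsBounded Ω) (hne : (frontier Ω).Nonempty) (hf : ContinuousOn f (closure Ω))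
    (hr : 0 < r)
    (hball : ∀ p ∈ frontier Ω, ∀ (ν : EuclideanSpace ℝ (Fin N)) (d : ℝ), 0 < d → ‖ν‖ = 1 →
      p + d • ν ∈ Ω → bdist Ω (p + d • ν) = d → ∀ y, ‖y - (p - r • ν)‖ < r → y ∉ Ω)
    {φ φ1 : ℝ → ℝ} {φ2 τ : ℝ} {x : EuclideanSpace ℝ (Fin N)} (hx : x ∈ Ω) (hτ : bdist Ω x < τ)
    (hmono : MonotoneOn φ (Set.Icc 0 τ))
    (hφ : ∀ᶠ t in 𝓝 (bdist Ω x), HasDerivAt φ (φ1 t) t) (hφ1 : HasDerivAt φ1 φ2 (bdist Ω x))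
    (hmax : IsLocalMax (fun y => u y - φ (bdist Ω y)) x) :
    -(f x * bdist Ω x ^ (-β)) ≤ φ2 + β * φ1 (bdist Ω x) / bdist Ω x +
      (N - 1) * φ1 (bdist Ω x) / (r + bdist Ω x) := by
  obtain ⟨p, hp, hxp, heq⟩ := hu.nondivergence hΩ hb hne hf hx
  have hd := bdist_pos hΩ hne hx
  set d := bdist Ω x with hdd
  obtain ⟨ν, hν, hpx⟩ : ∃ ν : EuclideanSpace ℝ (Fin N), ‖ν‖ = 1 ∧ x = p + d • ν := by
    refine ⟨d⁻¹ • (x - p), ?_, ?_⟩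
    · rw [norm_smul, hxp, Real.norm_of_nonneg (by positivity), inv_mul_cancel₀ hd.ne']
    · rw [smul_inv_smul₀ hd.ne']; abel
  have hext := hball p hp ν d hd hν (hpx ▸ hx) (by rw [← hpx])
  set R := r + d with hRd
  have hR : 0 < R := by positivity
  have hxq : x - (p - r • ν) = R • ν := by rw [hpx, hRd]; module
  have hnorm : ‖x - (p - r • ν)‖ = R := by
    rw [hxq, norm_smul, hν, Real.norm_of_nonneg hR.le, mul_one]
  have hκ : (1 : ℝ) * (R - r) = d := by rw [hRd]; ring
  have hG := eventually_hasDerivAt_radial hR hκ hφ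
  have hG1 := hasDerivAt_radial_deriv (by norm_num) hR hκ hφ1
  obtain ⟨h1, h2⟩ := touching_above hΩ hu.contDiffOn hx (q := p - r • ν)
    (by rw [hnorm]; exact hG) (by rw [hnorm]; exact hG1) (by
      have hc : Tendsto (fun y => ‖y - (p - r • ν)‖ - r) (𝓝 x) (𝓝 d) := by
        have : Continuous fun y => ‖y - (p - r • ν)‖ - r := by fun_prop
        have h := this.tendsto x
        rwa [hnorm, hRd, add_sub_cancel_left] at h
      filter_upwards [hmax, hΩ.mem_nhds hx, hc.eventually (gt_mem_nhds hτ)] with y hy hyΩ hyτ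
      -- Since `d(y) ≤ ‖y - q‖ - r` with equality at `x`, monotonicity of `φ` transfers the local
      -- maximum to the radial function.
      have h1 := bdist_le_of_exterior_ball hΩ hr hext hyΩ
      have h2 := hmono ⟨bdist_nonneg Ω y, h1.trans hyτ.le⟩
        ⟨(bdist_nonneg Ω y).trans h1, hyτ.le⟩ h1
      simp only [one_mul, Real.sqrt_sq (norm_nonneg _), hnorm]
      rw [Real.sqrt_sq hR.le, hRd, add_sub_cancel_left]
      linarith)
  rw [hnorm, Real.sqrt_sq hR.le, hκ] at h1 h2
  have hxp' : x - p = d • ν := by rw [hpx]; abel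
  rw [← heq, h1, hxq, hxp', real_inner_smul_left, real_inner_smul_right, real_inner_smul_right,
    real_inner_self_eq_norm_sq, hν]
  have e1 : 4 * R ^ 2 * (φ2 / (4 * R ^ 2) - 1 * φ1 d / (4 * R ^ 3)) +
      2 * N * (φ1 d * (1 * (1 / (2 * R)))) = φ2 + (N - 1) * φ1 d / R := by
    field_simp; ring
  have e2 : β / d ^ 2 * (d * (2 * (φ1 d * (1 * (1 / (2 * R)))) * (R * 1 ^ 2))) =
      β * φ1 d / d := by
    field_simp
  rw [e1] at h2
  rw [e2]
  linarith

/-- If `φ ∘ d` touches a solution from below at `x`, then `φ ∘ d` is a supersolution there up to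
the curvature term coming from an interior ball of radius `r`. -/
theorem IsSolution.contact_below (hu : IsSolution Ω β f u) (hΩ : IsOpen Ω)
    (hb : Bornology.IsBounded Ω) (hne : (frontier Ω).Nonempty) (hf : ContinuousOn f (closure Ω))
    (hball : ∀ p ∈ frontier Ω, ∀ (ν : EuclideanSpace ℝ (Fin N)) (d : ℝ), 0 < d → ‖ν‖ = 1 →
      p + d • ν ∈ Ω → bdist Ω (p + d • ν) = d → ∀ y, ‖y - (p + r • ν)‖ < r → y ∈ Ω)
    {φ φ1 : ℝ → ℝ} {φ2 τ : ℝ} {x : EuclideanSpace ℝ (Fin N)} (hx : x ∈ Ω) (hτ : bdist Ω x < τ)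
    (hxr : bdist Ω x < r) (hmono : MonotoneOn φ (Set.Icc 0 τ))
    (hφ : ∀ᶠ t in 𝓝 (bdist Ω x), HasDerivAt φ (φ1 t) t) (hφ1 : HasDerivAt φ1 φ2 (bdist Ω x))
    (hmin : IsLocalMin (fun y => u y - φ (bdist Ω y)) x) :
    φ2 + β * φ1 (bdist Ω x) / bdist Ω x - (N - 1) * φ1 (bdist Ω x) / (r - bdist Ω x) ≤
      -(f x * bdist Ω x ^ (-β)) := by
  obtain ⟨p, hp, hxp, heq⟩ := hu.nondivergence hΩ hb hne hf hx
  have hd := bdist_pos hΩ hne hx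
  set d := bdist Ω x with hdd
  obtain ⟨ν, hν, hpx⟩ : ∃ ν : EuclideanSpace ℝ (Fin N), ‖ν‖ = 1 ∧ x = p + d • ν := by
    refine ⟨d⁻¹ • (x - p), ?_, ?_⟩
    · rw [norm_smul, hxp, Real.norm_of_nonneg (by positivity), inv_mul_cancel₀ hd.ne']
    · rw [smul_inv_smul₀ hd.ne']; abel
  have hint := hball p hp ν d hd hν (hpx ▸ hx) (by rw [← hpx])
  set R := r - d with hRd
  have hR : 0 < R := sub_pos.2 hxr
  have hxq : x - (p + r • ν) = (-R) • ν := by rw [hpx, hRd]; module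
  have hnorm : ‖x - (p + r • ν)‖ = R := by
    rw [hxq, norm_smul, hν, norm_neg, Real.norm_of_nonneg hR.le, mul_one]
  have hκ : (-1 : ℝ) * (R - r) = d := by rw [hRd]; ring
  have hG := eventually_hasDerivAt_radial hR hκ hφ
  have hG1 := hasDerivAt_radial_deriv (by norm_num) hR hκ hφ1
  obtain ⟨h1, h2⟩ := touching_below hΩ hu.contDiffOn hx (q := p + r • ν)
    (by rw [hnorm]; exact hG) (by rw [hnorm]; exact hG1) (by
      have hc : Tendsto (fun y => r - ‖y - (p + r • ν)‖) (𝓝 x) (𝓝 d) := by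
        have : Continuous fun y => r - ‖y - (p + r • ν)‖ := by fun_prop
        have h := this.tendsto x
        rwa [hnorm, hRd, sub_sub_cancel] at h
      filter_upwards [hmin, (continuous_bdist Ω).continuousAt.eventually (gt_mem_nhds hτ),
        hc.eventually (lt_mem_nhds hd)] with y hy hyτ hy0
      -- Now `r - ‖y - q‖ ≤ d(y)` with equality at `x`; `hy0` keeps the smaller argument in the
      -- interval of monotonicity.
      have h1 := le_bdist_of_interior_ball hΩ hne hint y
      have h2 := hmono ⟨hy0.le, h1.trans hyτ.le⟩ ⟨bdist_nonneg Ω y, hyτ.le⟩ h1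
      simp only [neg_one_mul, neg_sub, Real.sqrt_sq (norm_nonneg _), hnorm]
      rw [Real.sqrt_sq hR.le, hRd, sub_sub_cancel]
      linarith)
  rw [hnorm, Real.sqrt_sq hR.le, hκ] at h1 h2
  have hxp' : x - p = d • ν := by rw [hpx]; abel
  rw [← heq, h1, hxq, hxp', real_inner_smul_left, real_inner_smul_right, real_inner_smul_right,
    real_inner_self_eq_norm_sq, hν]
  have e1 : 4 * R ^ 2 * (φ2 / (4 * R ^ 2) - -1 * φ1 d / (4 * R ^ 3)) +
      2 * N * (φ1 d * (-1 * (1 / (2 * R)))) = φ2 - (N - 1) * φ1 d / R := by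
    field_simp; ring
  have e2 : β / d ^ 2 * (d * (2 * (φ1 d * (-1 * (1 / (2 * R)))) * (-R * 1 ^ 2))) =
      β * φ1 d / d := by
    field_simp
  rw [e1] at h2
  rw [e2]
  linarith

end Contact

/-! ### Barrier profiles -/

/-- The profile `C (t^(1-β) - κ t^(3/2-β))` with derivative `C t^(-β) (1 - β - κ (3/2 - β) √t)`. -/
theorem hasDerivAt_profile (β C κ : ℝ) {t : ℝ} (ht : 0 < t) :
    HasDerivAt (fun t => C * (t ^ (1 - β) - κ * t ^ (3 / 2 - β)))
      (C * (t ^ (-β) * (1 - β - κ * (3 / 2 - β) * √t))) t := by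
  have h1 := Real.hasDerivAt_rpow_const (p := 1 - β) (Or.inl ht.ne')
  have h2 := Real.hasDerivAt_rpow_const (p := 3 / 2 - β) (Or.inl ht.ne')
  refine ((h1.fun_sub (h2.const_mul κ)).const_mul C).congr_deriv ?_
  have e1 : 1 - β - 1 = -β := by ring
  have e2 : 3 / 2 - β - 1 = -β + 1 / 2 := by ring
  rw [e1, e2, Real.rpow_add ht, ← Real.sqrt_eq_rpow]
  ring

/-- The first summand is written as `-β φ'/t`, so `φ'' + β φ'/t` is just the second one, whose sign
is opposite to that of `κ`. -/
theorem hasDerivAt_profile_deriv (β C κ : ℝ) {t : ℝ} (ht : 0 < t) :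
    HasDerivAt (fun t => C * (t ^ (-β) * (1 - β - κ * (3 / 2 - β) * √t)))
      (-(β * (C * (t ^ (-β) * (1 - β - κ * (3 / 2 - β) * √t))) / t) -
        C * κ * (3 / 2 - β) / (2 * √t) * t ^ (-β)) t := by
  have h1 := Real.hasDerivAt_rpow_const (p := -β) (Or.inl ht.ne')
  have h2 := ((Real.hasDerivAt_sqrt ht.ne').const_mul (κ * (3 / 2 - β))).const_sub (1 - β)
  refine ((h1.fun_mul h2).const_mul C).congr_deriv ?_
  rw [Real.rpow_sub_one ht.ne']
  have := Real.sqrt_pos.2 ht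
  field_simp
  ring

theorem monotoneOn_profile {β C κ τ : ℝ} (hβ : β < 1) (hC : 0 ≤ C)
    (hτ : ∀ t, 0 < t → t < τ → 0 ≤ 1 - β - κ * (3 / 2 - β) * √t) :
    MonotoneOn (fun t => C * (t ^ (1 - β) - κ * t ^ (3 / 2 - β))) (Set.Icc 0 τ) := by
  refine monotoneOn_of_deriv_nonneg (convex_Icc 0 τ) ?_ ?_ ?_
  · have h1 : Continuous fun t : ℝ => t ^ (1 - β) := Real.continuous_rpow_const (by linarith)
    have h2 : Continuous fun t : ℝ => t ^ (3 / 2 - β) := Real.continuous_rpow_const (by linarith)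
    fun_prop
  · rw [interior_Icc]
    exact fun t ht => (hasDerivAt_profile β C κ ht.1).differentiableAt.differentiableWithinAt
  · rw [interior_Icc]
    intro t ht
    rw [(hasDerivAt_profile β C κ ht.1).deriv]
    exact mul_nonneg hC (mul_nonneg (Real.rpow_nonneg ht.1.le _) (hτ t ht.1 ht.2))

/-- Widths of boundary strips on which the profiles are monotone and dominate the curvature. -/
theorem exists_strip_width (N : ℕ) {β r : ℝ} (hβ : β < 1) (hr : 0 < r) :
    ∃ τ > (0 : ℝ), τ ≤ r / 2 ∧ τ ≤ Real.exp (-1) ∧ ∀ t, 0 < t → t < τ →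
      √t ≤ 1 ∧ (3 / 2 - β) * √t ≤ 1 - β ∧
        N * (1 - β + (3 / 2 - β)) / r ≤ (3 / 2 - β) / (8 * √t) := by
  have ha : 0 < 1 - β := by linarith
  have hγ : 0 < 3 / 2 - β := by linarith
  -- The three entries yield the three conclusions on `√t`; `N + 1` keeps the denominator positive
  -- when `N = 0`. Below, `r / 2` keeps `r - d` at least `r/2`, and `exp (-1)` gives `-log d ≥ 1`.
  set k := min 1 (min ((1 - β) / (3 / 2 - β))
    (r * (3 / 2 - β) / (8 * ((N + 1) * (1 - β + (3 / 2 - β)))))) with hk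
  have hk0 : 0 < k := lt_min one_pos (lt_min (by positivity) (by positivity))
  refine ⟨min (k ^ 2) (min (r / 2) (Real.exp (-1))),
    lt_min (by positivity) (lt_min (by positivity) (Real.exp_pos _)),
    (min_le_right _ _).trans (min_le_left _ _), (min_le_right _ _).trans (min_le_right _ _),
    fun t ht htτ => ?_⟩
  have hw : √t < k := (Real.sqrt_lt' hk0).2 (htτ.trans_le (min_le_left _ _))
  have hw0 : 0 < √t := Real.sqrt_pos.2 ht
  refine ⟨hw.le.trans (min_le_left _ _), ?_, ?_⟩
  · have := hw.le.trans ((min_le_right _ _).trans (min_le_left _ _))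
    rwa [le_div_iff₀ hγ, mul_comm] at this
  · have := hw.le.trans ((min_le_right _ _).trans (min_le_right _ _))
    rw [le_div_iff₀ (by positivity)] at this
    rw [div_le_div_iff₀ hr (by positivity)]
    have h2 : 0 < √t * (1 - β + (3 / 2 - β)) := by positivity
    nlinarith

/-! ### Barrier comparison in the strip -/

section Bounds

variable {Ω : Set (EuclideanSpace ℝ (Fin N))} {β r τ : ℝ} {f u : EuclideanSpace ℝ (Fin N) → ℝ}

theorem mem_frontier_of_bdist_eq_zero (hne : (frontier Ω).Nonempty)
    {x : EuclideanSpace ℝ (Fin N)} (hx : bdist Ω x = 0) : x ∈ frontier Ω :=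
  (isClosed_frontier.mem_iff_infDist_zero hne).2 hx

theorem mem_of_mem_closure_of_bdist_pos {x : EuclideanSpace ℝ (Fin N)} (hx : x ∈ closure Ω)
    (hd : 0 < bdist Ω x) : x ∈ Ω := by
  by_contra h
  have : x ∈ frontier Ω := ⟨hx, fun hi => h (interior_subset hi)⟩
  exact hd.ne' (Metric.infDist_zero_of_mem this)

theorem isCompact_closure_inter_bdist_le (hb : Bornology.IsBounded Ω) (σ : ℝ) :
    IsCompact (closure Ω ∩ {x | bdist Ω x ≤ σ}) :=
  hb.isCompact_closure.inter_right (isClosed_le (continuous_bdist Ω) continuous_const)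

theorem IsSolution.exists_upper_bound (hu : IsSolution Ω β f u) (hΩ : IsOpen Ω)
    (hb : Bornology.IsBounded Ω) (hne : (frontier Ω).Nonempty) (hf : ContinuousOn f (closure Ω))
    (hβ : β < 1) (hr : 0 < r)
    (hball : ∀ p ∈ frontier Ω, ∀ (ν : EuclideanSpace ℝ (Fin N)) (d : ℝ), 0 < d → ‖ν‖ = 1 →
      p + d • ν ∈ Ω → bdist Ω (p + d • ν) = d → ∀ y, ‖y - (p - r • ν)‖ < r → y ∉ Ω)
    (hτ : ∀ t, 0 < t → t < τ → √t ≤ 1 ∧ (3 / 2 - β) * √t ≤ 1 - β ∧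
      N * (1 - β + (3 / 2 - β)) / r ≤ (3 / 2 - β) / (8 * √t))
    {σ : ℝ} (hσ : 0 < σ) (hσ1 : σ < 1) (hστ : σ < τ) :
    ∃ C > (0 : ℝ), ∀ x ∈ closure Ω, bdist Ω x ≤ σ → u x ≤ C * bdist Ω x ^ (1 - β) := by
  have ha : 0 < 1 - β := by linarith
  have hγ : 0 < 3 / 2 - β := by linarith
  obtain ⟨M, hM⟩ := hb.isCompact_closure.bddAbove_image hf
  obtain ⟨Mu, hMu⟩ := hb.isCompact_closure.bddAbove_image hu.continuousOn
  have hφσ : 0 < σ ^ (1 - β) - 1 * σ ^ (3 / 2 - β) := by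
    have := Real.rpow_lt_rpow_of_exponent_gt hσ hσ1 (show 1 - β < 3 / 2 - β by linarith)
    linarith
  -- The first summand beats `f` at an interior contact, with the `+ 1` giving strictness; the
  -- second puts the barrier above `u` on `d = σ`.
  set C := 8 * (|M| + 1) / (3 * (3 / 2 - β)) +
    |Mu| / (σ ^ (1 - β) - 1 * σ ^ (3 / 2 - β)) with hC
  have hC1 : |M| + 1 ≤ C * (3 * (3 / 2 - β)) / 8 := by
    have h1 : 0 ≤ |Mu| / (σ ^ (1 - β) - 1 * σ ^ (3 / 2 - β)) := by positivity
    have h2 : 8 * (|M| + 1) / (3 * (3 / 2 - β)) ≤ C := by linarith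
    rw [div_le_iff₀ (by positivity)] at h2
    linarith
  have hC2 : |Mu| ≤ C * (σ ^ (1 - β) - 1 * σ ^ (3 / 2 - β)) := by
    rw [← div_le_iff₀ hφσ]
    have h1 : 0 ≤ 8 * (|M| + 1) / (3 * (3 / 2 - β)) := by positivity
    linarith
  have hC0 : 0 < C := by positivity
  set φ : ℝ → ℝ := fun t => C * (t ^ (1 - β) - 1 * t ^ (3 / 2 - β)) with hφ
  have hmono : MonotoneOn φ (Set.Icc 0 τ) := monotoneOn_profile hβ hC0.le fun t ht0 ht => by
    linarith [(hτ t ht0 ht).2.1]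
  refine ⟨C, hC0, fun x hx hxσ => ?_⟩
  have hφc : Continuous φ := by
    have h1 : Continuous fun t : ℝ => t ^ (1 - β) := Real.continuous_rpow_const ha.le
    have h2 : Continuous fun t : ℝ => t ^ (3 / 2 - β) := Real.continuous_rpow_const hγ.le
    fun_prop
  obtain ⟨x₀, ⟨hx₀, hx₀σ⟩, hmax⟩ :=
    (isCompact_closure_inter_bdist_le hb σ).exists_isMaxOn ⟨x, hx, hxσ⟩
      ((hu.continuousOn.mono Set.inter_subset_left).sub
        (hφc.comp (continuous_bdist Ω)).continuousOn)
  have hxx₀ : u x - φ (bdist Ω x) ≤ u x₀ - φ (bdist Ω x₀) := hmax ⟨hx, hxσ⟩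
  have hle : u x₀ - φ (bdist Ω x₀) ≤ 0 := by
    rcases (bdist_nonneg Ω x₀).eq_or_lt with h0 | h0
    · rw [hu.boundary _ (mem_frontier_of_bdist_eq_zero hne h0.symm), ← h0]
      simp [hφ, Real.zero_rpow ha.ne', Real.zero_rpow hγ.ne']
    rcases (show bdist Ω x₀ ≤ σ from hx₀σ).eq_or_lt with h1 | h1
    · have := hMu ⟨x₀, hx₀, rfl⟩
      rw [h1]
      linarith [le_abs_self Mu]
    exfalso
    have hxΩ := mem_of_mem_closure_of_bdist_pos hx₀ h0
    have hloc : IsLocalMax (fun y => u y - φ (bdist Ω y)) x₀ := by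
      filter_upwards [hΩ.mem_nhds hxΩ,
        (continuous_bdist Ω).continuousAt.eventually (gt_mem_nhds h1)] with y hy hy'
      exact hmax ⟨subset_closure hy, hy'.le⟩
    have key := hu.contact_above hΩ hb hne hf hr hball hxΩ (h1.trans hστ) hmono
      (by filter_upwards [lt_mem_nhds h0] with t ht using hasDerivAt_profile β C 1 ht)
      (hasDerivAt_profile_deriv β C 1 h0) hloc
    obtain ⟨hw1, hwa, hwN⟩ := hτ _ h0 (h1.trans hστ)
    have hfM : f x₀ ≤ M := hM ⟨x₀, hx₀, rfl⟩
    set d := bdist Ω x₀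
    have hw0 : 0 < √d := Real.sqrt_pos.2 h0
    have hP : 0 < d ^ (-β) := Real.rpow_pos_of_pos h0 _
    have hcurv : (N - 1) * (1 - β - 1 * (3 / 2 - β) * √d) / (r + d) ≤ (3 / 2 - β) / (8 * √d) := by
      refine le_trans ?_ hwN
      have h2 : 0 ≤ 1 - β - 1 * (3 / 2 - β) * √d := by linarith
      have h3 : (N - 1 : ℝ) * (1 - β - 1 * (3 / 2 - β) * √d) ≤ N * (1 - β + (3 / 2 - β)) := by
        have h4 : 0 ≤ (3 / 2 - β) * √d := by positivity
        calc (N - 1 : ℝ) * (1 - β - 1 * (3 / 2 - β) * √d)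
            ≤ N * (1 - β - 1 * (3 / 2 - β) * √d) := by gcongr; linarith
          _ ≤ N * (1 - β + (3 / 2 - β)) := by gcongr; linarith
      have h5 : (0 : ℝ) ≤ N * (1 - β + (3 / 2 - β)) := by positivity
      calc (N - 1 : ℝ) * (1 - β - 1 * (3 / 2 - β) * √d) / (r + d)
          ≤ N * (1 - β + (3 / 2 - β)) / (r + d) := by gcongr
        _ ≤ N * (1 - β + (3 / 2 - β)) / r := by gcongr; linarith
    have e : -(β * (C * (d ^ (-β) * (1 - β - 1 * (3 / 2 - β) * √d))) / d) -
        C * 1 * (3 / 2 - β) / (2 * √d) * d ^ (-β) +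
        β * (C * (d ^ (-β) * (1 - β - 1 * (3 / 2 - β) * √d))) / d +
        (N - 1) * (C * (d ^ (-β) * (1 - β - 1 * (3 / 2 - β) * √d))) / (r + d) =
        (C * (-4 * ((3 / 2 - β) / (8 * √d)) +
          (N - 1) * (1 - β - 1 * (3 / 2 - β) * √d) / (r + d))) * d ^ (-β) := by
      field_simp
      ring
    rw [e, ← neg_mul] at key
    have key' := le_of_mul_le_mul_right key hP
    have h6 : (3 / 2 - β) / 8 ≤ (3 / 2 - β) / (8 * √d) := by
      gcongr
      linarith
    have h7 : C * (-4 * ((3 / 2 - β) / (8 * √d)) +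
          (N - 1) * (1 - β - 1 * (3 / 2 - β) * √d) / (r + d)) ≤ C * (-3 * ((3 / 2 - β) / 8)) := by
      gcongr
      linarith
    linarith [le_abs_self M]
  have hφx : φ (bdist Ω x) ≤ C * bdist Ω x ^ (1 - β) := by
    have := Real.rpow_nonneg (bdist_nonneg Ω x) (3 / 2 - β)
    simp only [hφ]
    gcongr
    linarith
  linarith

/-- The constant `c` comes from the positive minimum of `u` on the compact level `d = σ`. At an
interior contact the strict subsolution contradicts `f ≥ 0`, whatever the size of `c`. -/
theorem IsSolution.exists_lower_bound (hu : IsSolution Ω β f u) (hΩ : IsOpen Ω)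
    (hb : Bornology.IsBounded Ω) (hne : (frontier Ω).Nonempty) (hf : ContinuousOn f (closure Ω))
    (hf0 : ∀ x ∈ Ω, 0 ≤ f x) (hupos : ∀ x ∈ Ω, 0 < u x) (hβ : β < 1) (hr : 0 < r)
    (hball : ∀ p ∈ frontier Ω, ∀ (ν : EuclideanSpace ℝ (Fin N)) (d : ℝ), 0 < d → ‖ν‖ = 1 →
      p + d • ν ∈ Ω → bdist Ω (p + d • ν) = d → ∀ y, ‖y - (p + r • ν)‖ < r → y ∈ Ω)
    (hτ : ∀ t, 0 < t → t < τ → √t ≤ 1 ∧ (3 / 2 - β) * √t ≤ 1 - β ∧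
      N * (1 - β + (3 / 2 - β)) / r ≤ (3 / 2 - β) / (8 * √t)) (hτr : τ ≤ r / 2)
    {σ : ℝ} (hσ : 0 < σ) (hστ : σ < τ) :
    ∃ c > (0 : ℝ), ∀ x ∈ closure Ω, bdist Ω x ≤ σ → c * bdist Ω x ^ (1 - β) ≤ u x := by
  have ha : 0 < 1 - β := by linarith
  have hγ : 0 < 3 / 2 - β := by linarith
  obtain ⟨c, hc, hcσ⟩ : ∃ c > (0 : ℝ), ∀ x ∈ closure Ω, bdist Ω x = σ →
      c * (σ ^ (1 - β) - (-1) * σ ^ (3 / 2 - β)) ≤ u x := by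
    have hK : IsCompact (closure Ω ∩ {x | bdist Ω x = σ}) :=
      hb.isCompact_closure.inter_right (isClosed_eq (continuous_bdist Ω) continuous_const)
    have hφσ : 0 < σ ^ (1 - β) - (-1) * σ ^ (3 / 2 - β) := by
      rw [neg_one_mul, sub_neg_eq_add]; positivity
    rcases (closure Ω ∩ {x | bdist Ω x = σ}).eq_empty_or_nonempty with he | hn
    · refine ⟨1, one_pos, fun x hx hxσ => ?_⟩
      have : x ∈ closure Ω ∩ {x | bdist Ω x = σ} := ⟨hx, hxσ⟩
      simp [he] at this
    · obtain ⟨x₁, ⟨hx₁, hx₁σ⟩, hmin⟩ :=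
        hK.exists_isMinOn hn (hu.continuousOn.mono Set.inter_subset_left)
      have hx₁σ' : bdist Ω x₁ = σ := hx₁σ
      have hpos := hupos x₁ (mem_of_mem_closure_of_bdist_pos hx₁ (hx₁σ' ▸ hσ))
      refine ⟨u x₁ / (σ ^ (1 - β) - (-1) * σ ^ (3 / 2 - β)), by positivity, fun x hx hxσ => ?_⟩
      rw [div_mul_cancel₀ _ hφσ.ne']
      exact hmin ⟨hx, hxσ⟩
  set φ : ℝ → ℝ := fun t => c * (t ^ (1 - β) - (-1) * t ^ (3 / 2 - β)) with hφ
  have hmono : MonotoneOn φ (Set.Icc 0 τ) := monotoneOn_profile hβ hc.le fun t ht0 ht => by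
    have : 0 ≤ (3 / 2 - β) * √t := by positivity
    linarith
  refine ⟨c, hc, fun x hx hxσ => ?_⟩
  have hφc : Continuous φ := by
    have h1 : Continuous fun t : ℝ => t ^ (1 - β) := Real.continuous_rpow_const ha.le
    have h2 : Continuous fun t : ℝ => t ^ (3 / 2 - β) := Real.continuous_rpow_const hγ.le
    fun_prop
  obtain ⟨x₀, ⟨hx₀, hx₀σ⟩, hmin⟩ :=
    (isCompact_closure_inter_bdist_le hb σ).exists_isMinOn ⟨x, hx, hxσ⟩
      ((hu.continuousOn.mono Set.inter_subset_left).sub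
        (hφc.comp (continuous_bdist Ω)).continuousOn)
  have hxx₀ : u x₀ - φ (bdist Ω x₀) ≤ u x - φ (bdist Ω x) := hmin ⟨hx, hxσ⟩
  have hle : 0 ≤ u x₀ - φ (bdist Ω x₀) := by
    rcases (bdist_nonneg Ω x₀).eq_or_lt with h0 | h0
    · rw [hu.boundary _ (mem_frontier_of_bdist_eq_zero hne h0.symm), ← h0]
      simp [hφ, Real.zero_rpow ha.ne', Real.zero_rpow hγ.ne']
    rcases (show bdist Ω x₀ ≤ σ from hx₀σ).eq_or_lt with h1 | h1
    · have := hcσ x₀ hx₀ h1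
      rw [h1]
      linarith
    exfalso
    have hxΩ := mem_of_mem_closure_of_bdist_pos hx₀ h0
    have hloc : IsLocalMin (fun y => u y - φ (bdist Ω y)) x₀ := by
      filter_upwards [hΩ.mem_nhds hxΩ,
        (continuous_bdist Ω).continuousAt.eventually (gt_mem_nhds h1)] with y hy hy'
      exact hmin ⟨subset_closure hy, hy'.le⟩
    have hdr : bdist Ω x₀ < r / 2 := h1.trans (hστ.trans_le hτr)
    have key := hu.contact_below hΩ hb hne hf hball hxΩ (h1.trans hστ)
      (by linarith) hmono
      (by filter_upwards [lt_mem_nhds h0] with t ht using hasDerivAt_profile β c (-1) ht)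
      (hasDerivAt_profile_deriv β c (-1) h0) hloc
    obtain ⟨hw1, -, hwN⟩ := hτ _ h0 (h1.trans hστ)
    have hfx := hf0 x₀ hxΩ
    set d := bdist Ω x₀
    have hw0 : 0 < √d := Real.sqrt_pos.2 h0
    have hP : 0 < d ^ (-β) := Real.rpow_pos_of_pos h0 _
    have hrd : 0 < r - d := by linarith
    -- Since `r - d ≥ r/2`, curvature costs at most two of the four units.
    have hcurv : (N - 1) * (1 - β - (-1) * (3 / 2 - β) * √d) / (r - d) ≤
        2 * ((3 / 2 - β) / (8 * √d)) := by
      have h4 : 0 ≤ (3 / 2 - β) * √d := by positivity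
      have h4' : (3 / 2 - β) * √d ≤ 3 / 2 - β := mul_le_of_le_one_right hγ.le hw1
      have h3 : (N - 1 : ℝ) * (1 - β - (-1) * (3 / 2 - β) * √d) ≤ N * (1 - β + (3 / 2 - β)) := by
        have h2 : 0 ≤ 1 - β - (-1) * (3 / 2 - β) * √d := by linarith
        calc (N - 1 : ℝ) * (1 - β - (-1) * (3 / 2 - β) * √d)
            ≤ N * (1 - β - (-1) * (3 / 2 - β) * √d) := by gcongr; linarith
          _ ≤ N * (1 - β + (3 / 2 - β)) := by gcongr; linarith
      have h5 : (0 : ℝ) ≤ N * (1 - β + (3 / 2 - β)) := by positivity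
      calc (N - 1 : ℝ) * (1 - β - (-1) * (3 / 2 - β) * √d) / (r - d)
          ≤ N * (1 - β + (3 / 2 - β)) / (r - d) := by gcongr
        _ ≤ N * (1 - β + (3 / 2 - β)) / (r / 2) := by gcongr; linarith
        _ = 2 * (N * (1 - β + (3 / 2 - β)) / r) := by field_simp
        _ ≤ _ := by gcongr
    have e : -(β * (c * (d ^ (-β) * (1 - β - (-1) * (3 / 2 - β) * √d))) / d) -
        c * (-1) * (3 / 2 - β) / (2 * √d) * d ^ (-β) +
        β * (c * (d ^ (-β) * (1 - β - (-1) * (3 / 2 - β) * √d))) / d -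
        (N - 1) * (c * (d ^ (-β) * (1 - β - (-1) * (3 / 2 - β) * √d))) / (r - d) =
        (c * (4 * ((3 / 2 - β) / (8 * √d)) -
          (N - 1) * (1 - β - (-1) * (3 / 2 - β) * √d) / (r - d))) * d ^ (-β) := by
      field_simp
      ring
    rw [e, ← neg_mul] at key
    have key' := le_of_mul_le_mul_right key hP
    have h6 : 0 < (3 / 2 - β) / (8 * √d) := by positivity
    have h7 : 0 < c * (4 * ((3 / 2 - β) / (8 * √d)) -
          (N - 1) * (1 - β - (-1) * (3 / 2 - β) * √d) / (r - d)) :=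
      mul_pos hc (by linarith)
    linarith
  have hφx : c * bdist Ω x ^ (1 - β) ≤ φ (bdist Ω x) := by
    have := Real.rpow_nonneg (bdist_nonneg Ω x) (3 / 2 - β)
    simp only [hφ]
    gcongr
    linarith
  linarith

end Bounds

/-! ### The two-sided bound and the theorem -/

theorem frontier_nonempty_of_isSolution {Ω : Set (EuclideanSpace ℝ (Fin N))}
    (hb : Bornology.IsBounded Ω) {β : ℝ} {f u : EuclideanSpace ℝ (Fin N) → ℝ}
    (hfne : ∃ x ∈ Ω, f x ≠ 0) (hu : IsSolution Ω β f u) : (frontier Ω).Nonempty := by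
  obtain ⟨x, hx, hfx⟩ := hfne
  refine nonempty_frontier_iff.2 ⟨⟨x, hx⟩, fun huniv => ?_⟩
  -- In dimension zero the whole space is bounded, but the divergence is an empty sum, which forces
  -- `f = 0`.
  rcases Nat.eq_zero_or_pos N with rfl | hN
  · obtain ⟨y, hy⟩ := hu.equation.exists
    obtain rfl : y = x := Subsingleton.elim _ _
    exact hfx (by simpa [divergence] using (hy hx).2.symm)
  · have : Nonempty (Fin N) := ⟨⟨0, hN⟩⟩
    exact NormedSpace.unbounded_univ ℝ (EuclideanSpace ℝ (Fin N)) (huniv ▸ hb)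

/-- Log-free two-sided bound near the boundary. -/
theorem IsSolution.exists_two_sided_bound {Ω : Set (EuclideanSpace ℝ (Fin N))} (hΩ : IsOpen Ω)
    (hconn : IsConnected Ω) (hb : Bornology.IsBounded Ω) (hC2 : HasC2Boundary Ω) {β : ℝ}
    (hβ : β < 1) {f u : EuclideanSpace ℝ (Fin N) → ℝ} (hf : ContinuousOn f (closure Ω))
    (hf0 : ∀ x ∈ Ω, 0 ≤ f x) (hfne : ∃ x ∈ Ω, f x ≠ 0) (hu : IsSolution Ω β f u) :
    ∃ σ > (0 : ℝ), σ ≤ Real.exp (-1) ∧ ∃ c > (0 : ℝ), ∃ C > (0 : ℝ), ∀ x ∈ strip Ω σ,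
      c * bdist Ω x ^ (1 - β) ≤ u x ∧ u x ≤ C * bdist Ω x ^ (1 - β) := by
  have hne := frontier_nonempty_of_isSolution hb hfne hu
  obtain ⟨r, hr, hball⟩ := hC2.exists_uniform_balls hΩ hb
  obtain ⟨τ, hτ0, hτr, hτe, hτ⟩ := exists_strip_width N hβ hr
  have hσe : τ / 2 ≤ Real.exp (-1) := by linarith
  have he1 : Real.exp (-1) < 1 := by simp
  obtain ⟨C, hC, hupper⟩ := hu.exists_upper_bound hΩ hb hne hf hβ hr
    (fun p hp ν d h1 h2 h3 h4 => (hball p hp ν d h1 h2 h3 h4).2) hτ (half_pos hτ0)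
    (hσe.trans_lt he1) (half_lt_self hτ0)
  obtain ⟨c, hc, hlower⟩ := hu.exists_lower_bound hΩ hb hne hf hf0
    (fun x hx => hu.pos hΩ hconn hb hne hf hf0 hfne hx) hβ hr
    (fun p hp ν d h1 h2 h3 h4 => (hball p hp ν d h1 h2 h3 h4).1) hτ hτr (half_pos hτ0)
    (half_lt_self hτ0)
  exact ⟨τ / 2, half_pos hτ0, hσe, c, hc, C, hC, fun x hx =>
    ⟨hlower x hx.1 hx.2.le, hupper x hx.1 hx.2.le⟩⟩

end DegPoisson

theorem theorem1p2 {N : ℕ} (Ω : Set (EuclideanSpace ℝ (Fin N)))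
    (hΩ_open : IsOpen Ω) (hΩ_conn : IsConnected Ω) (hΩ_bdd : Bornology.IsBounded Ω)
    (hΩ_C2 : DegPoisson.HasC2Boundary Ω)
    (β : ℝ) (hβ : β < 1)
    (f u : EuclideanSpace ℝ (Fin N) → ℝ)
    (hf_cont : ContinuousOn f (closure Ω)) (hf_nonneg : ∀ x ∈ Ω, 0 ≤ f x)
    (hf_ne : ∃ x ∈ Ω, f x ≠ 0)
    (hu : DegPoisson.IsSolution Ω β f u) :
    ∀ η₁ > (0 : ℝ), ∀ η₂ > (0 : ℝ),
      ∃ σ > (0 : ℝ), σ < 1 ∧ ∃ D₁ > (0 : ℝ), ∃ D₂ > (0 : ℝ),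
        (∀ x ∈ interior (DegPoisson.strip Ω σ),
          D₁ * DegPoisson.bdist Ω x ^ (1 - β) * (-Real.log (DegPoisson.bdist Ω x)) ^ (-η₁) ≤ u x ∧
          u x ≤ D₂ * DegPoisson.bdist Ω x ^ (1 - β) *
            (-Real.log (DegPoisson.bdist Ω x)) ^ η₂) ∧
        (Convex ℝ Ω → ∀ x ∈ DegPoisson.strip Ω σ,
          D₁ * DegPoisson.bdist Ω x ^ (1 - β) * (-Real.log (DegPoisson.bdist Ω x)) ^ (-η₁) ≤ u x ∧
          u x ≤ D₂ * DegPoisson.bdist Ω x ^ (1 - β)) := by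
  intro η₁ hη₁ η₂ hη₂
  obtain ⟨σ, hσ, hσe, c, hc, C, hC, h⟩ := hu.exists_two_sided_bound hΩ_open hΩ_conn hΩ_bdd hΩ_C2 hβ
    hf_cont hf_nonneg hf_ne
  have ha : 1 - β ≠ 0 := by linarith
  have hlog : ∀ x ∈ DegPoisson.strip Ω σ, 0 < DegPoisson.bdist Ω x →
      1 ≤ -Real.log (DegPoisson.bdist Ω x) := fun x hx hd => by
    have := Real.log_le_log hd (hx.2.le.trans hσe)
    rw [Real.log_exp] at this
    linarith
  have hlow : ∀ x ∈ DegPoisson.strip Ω σ,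
      c * DegPoisson.bdist Ω x ^ (1 - β) * (-Real.log (DegPoisson.bdist Ω x)) ^ (-η₁) ≤ u x := by
    intro x hx
    refine le_trans ?_ (h x hx).1
    -- On the boundary `d^(1-β) = 0`, so the value assigned to the logarithmic factor does not
    -- matter.
    rcases (DegPoisson.bdist_nonneg Ω x).eq_or_lt with h0 | h0
    · simp [← h0, Real.zero_rpow ha]
    · exact mul_le_of_le_one_right (by positivity)
        (Real.rpow_le_one_of_one_le_of_nonpos (hlog x hx h0) (by linarith))
  refine ⟨σ, hσ, hσe.trans_lt (by simp), c, hc, C, hC,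
    fun x hx => ⟨hlow x (interior_subset hx), ?_⟩, fun _ x hx => ⟨hlow x hx, (h x hx).2⟩⟩
  refine (h x (interior_subset hx)).2.trans ?_
  rcases (DegPoisson.bdist_nonneg Ω x).eq_or_lt with h0 | h0
  · simp [← h0, Real.zero_rpow ha]
  · exact le_mul_of_one_le_right (by positivity)
      (Real.one_le_rpow (hlog x (interior_subset hx) h0) hη₂.le)
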